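/- Let $M$ be a smooth manifold of dimension $2n+1$. For a $1$-form $\eta$ we use the convention $2\,d\eta(X,Y)=X(\eta(Y))-Y(\eta(X))-\eta([X,Y])$. A paracontact metric structure on $M$ is a quadruple $(\psi,\xi,\eta,g)$ of smooth tensor fields, where $\psi$ is a $(1,1)$-tensor field, $\xi$ a vector field, $\eta$ a $1$-form and $g$ a semi-Riemannian metric, such that (i) $\eta(\xi)=1$ and $\psi^2=I-\eta\otimes\xi$; (ii) at every point the eigenspaces of $\psi|_{\ker\eta}$ for the eigenvalues $1$ and $-1$ both have dimension $n$; (iii) $g(\psi X,\psi Y)=-g(X,Y)+\eta(X)\eta(Y)$; (iv) $d\eta(X,Y)=g(X,\psi Y)$. It is called para-Sasakian if, moreover, it is normal, i.e. $N_\psi-2\,d\eta\otimes\xi=0$, where $N_\psi(X,Y)=\psi^2[X,Y]+[\psi X,\psi Y]-\psi[\psi X,Y]-\psi[X,\psi Y]$. Let $\nabla$ be the Levi-Civita connection of $g$ and $h=\tfrac12\mathcal L_\xi\psi$. The canonical paracontact connection is $$\nabla^{pc}_XY=\nabla_XY+\eta(X)\psi Y+\eta(Y)(\psi X-\psi hX)+g(X-hX,\psi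 Y)\xi .$$ The standard para-Sasakian structure on $\mathbb R^{2n+1}$, with coordinates $(x_1,\dots,x_n,y_1,\dots,y_n,z)$, is given by $\eta=dz-\sum_{i=1}^n y_i\,dx_i$, $\xi=\partial/\partial z$, by $\psi(\partial/\partial x_i)=-\partial/\partial x_i-y_i\,\partial/\partial z$, $\psi(\partial/\partial y_i)=\partial/\partial y_i$, $\psi(\partial/\partial z)=0$, and by $g=\eta\otimes\eta+\tfrac12\sum_{i=1}^n(dx_i\otimes dy_i+dy_i\otimes dx_i)$. **Proposition.** Let $(\psi,\xi,\eta,g)$ be a para-Sasakian structure on $M$. If the curvature of $\nabla^{pc}$ vanishes everywhere on $M$, then $(M,\psi,\xi,\eta,g)$ is locally isomorphic to the standard para-Sasakian structure on $\mathbb R^{2n+1}$: every point of $M$ has an open neighbourhood $U$ with a smooth diffeomorphism $\Phi$ of $U$ onto an open subset of $\mathbb R^{2n+1}$ that carries $\psi,\xi,\eta,g$ to the corresponding standard tensors. -/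

import Mathlib

open Bundle
open scoped Manifold ContDiff Topology

noncomputable section

section Fields

variable {E : Type*} [NormedAddCommGroup E] [NormedSpace ℝ E]
  {M : Type*} [TopologicalSpace M] [ChartedSpace E M]

/-- A vector field on a manifold `M` modelled on `E` (no regularity included). -/
abbrev VField (E : Type*) [NormedAddCommGroup E] [NormedSpace ℝ E]
    (M : Type*) [TopologicalSpace M] [ChartedSpace E M] : Type _ :=
  ∀ x : M, TangentSpace 𝓘(ℝ, E) x

/-- A field of endomorphisms of the tangent spaces, that is, a `(1,1)`-tensor field. -/
abbrev EndField (E : Type*) [NormedAddCommGroup E] [NormedSpace ℝ E]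
    (M : Type*) [TopologicalSpace M] [ChartedSpace E M] : Type _ :=
  ∀ x : M, TangentSpace 𝓘(ℝ, E) x →L[ℝ] TangentSpace 𝓘(ℝ, E) x

/-- A field of covectors, that is, a `1`-form. -/
abbrev CovField (E : Type*) [NormedAddCommGroup E] [NormedSpace ℝ E]
    (M : Type*) [TopologicalSpace M] [ChartedSpace E M] : Type _ :=
  ∀ x : M, TangentSpace 𝓘(ℝ, E) x →L[ℝ] ℝ

/-- A field of bilinear forms on the tangent spaces. -/
abbrev BilinField (E : Type*) [NormedAddCommGroup E] [NormedSpace ℝ E]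
    (M : Type*) [TopologicalSpace M] [ChartedSpace E M] : Type _ :=
  ∀ x : M, TangentSpace 𝓘(ℝ, E) x →L[ℝ] TangentSpace 𝓘(ℝ, E) x →L[ℝ] ℝ

variable [IsManifold 𝓘(ℝ, E) ∞ M]

/-- `C^∞` vector fields. -/
def VField.Smooth (X : VField E M) : Prop :=
  ContMDiff 𝓘(ℝ, E) (𝓘(ℝ, E).prod 𝓘(ℝ, E)) ∞
    (fun x ↦ TotalSpace.mk' E (E := fun x : M ↦ TangentSpace 𝓘(ℝ, E) x) x (X x))

/-- `C^∞` fields of endomorphisms. -/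
def EndField.Smooth (A : EndField E M) : Prop :=
  ContMDiff 𝓘(ℝ, E) (𝓘(ℝ, E).prod 𝓘(ℝ, E →L[ℝ] E)) ∞
    (fun x ↦ TotalSpace.mk' (E →L[ℝ] E)
      (E := fun x : M ↦ TangentSpace 𝓘(ℝ, E) x →L[ℝ] TangentSpace 𝓘(ℝ, E) x) x (A x))

/-- `C^∞` one-forms. -/
def CovField.Smooth (η : CovField E M) : Prop :=
  ContMDiff 𝓘(ℝ, E) (𝓘(ℝ, E).prod 𝓘(ℝ, E →L[ℝ] ℝ)) ∞
    (fun x ↦ TotalSpace.mk' (E →L[ℝ] ℝ)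
      (E := fun x : M ↦ TangentSpace 𝓘(ℝ, E) x →L[ℝ] Trivial M ℝ x) x (η x))

/-- `C^∞` fields of bilinear forms. -/
def BilinField.Smooth (g : BilinField E M) : Prop :=
  ContMDiff 𝓘(ℝ, E) (𝓘(ℝ, E).prod 𝓘(ℝ, E →L[ℝ] E →L[ℝ] ℝ)) ∞
    (fun x ↦ TotalSpace.mk' (E →L[ℝ] E →L[ℝ] ℝ)
      (E := fun x : M ↦ TangentSpace 𝓘(ℝ, E) x →L[ℝ] TangentSpace 𝓘(ℝ, E) x →L[ℝ] Trivial M ℝ x)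
      x (g x))

lemma EndField.Smooth.mdifferentiableAt {A : EndField E M} (hA : A.Smooth) {x : M}
    {Y : VField E M} (hY : MDiffAt (T% Y) x) : MDiffAt (T% (fun y ↦ A y (Y y))) x := by
  have h := (hA x).mdifferentiableAt (by simp)
  exact MDifferentiableAt.clm_bundle_apply (b := fun y : M ↦ y) h hY

lemma CovField.Smooth.mdifferentiableAt {η : CovField E M} (hη : η.Smooth) {x : M}
    {Y : VField E M} (hY : MDiffAt (T% Y) x) : MDiffAt (fun y ↦ η y (Y y)) x := by
  have h := (hη x).mdifferentiableAt (by simp)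
  have := MDifferentiableAt.clm_bundle_apply (b := fun y : M ↦ y) h hY
  rw [mdifferentiableAt_totalSpace] at this
  exact this.2

lemma BilinField.Smooth.mdifferentiableAt {g : BilinField E M} (hg : g.Smooth) {x : M}
    {Y Z : VField E M} (hY : MDiffAt (T% Y) x) (hZ : MDiffAt (T% Z) x) :
    MDiffAt (fun y ↦ g y (Y y) (Z y)) x := by
  have h := (hg x).mdifferentiableAt (by simp)
  have := MDifferentiableAt.clm_bundle_apply₂ (b := fun y : M ↦ y) h hY hZ
  rw [mdifferentiableAt_totalSpace] at this
  exact this.2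

end Fields

section LeviCivita

variable {E : Type*} [NormedAddCommGroup E] [NormedSpace ℝ E]
  {M : Type*} [TopologicalSpace M] [ChartedSpace E M]

/-- The right-hand side of the Koszul formula,
`X g(Y,Z) + Y g(X,Z) - Z g(X,Y) + g([X,Y],Z) - g([X,Z],Y) - g([Y,Z],X)`, at the point `x`. -/
def koszul (g : BilinField E M) (Y X Z : VField E M) (x : M) : ℝ :=
  d% (fun y ↦ g y (Y y) (Z y)) x (X x) + d% (fun y ↦ g y (X y) (Z y)) x (Y x)
    - d% (fun y ↦ g y (X y) (Y y)) x (Z x)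
    + g x (VectorField.mlieBracket 𝓘(ℝ, E) X Y x) (Z x)
    - g x (VectorField.mlieBracket 𝓘(ℝ, E) X Z x) (Y x)
    - g x (VectorField.mlieBracket 𝓘(ℝ, E) Y Z x) (X x)

variable [IsManifold 𝓘(ℝ, E) ∞ M]

/-- Semi-Riemannian metrics: smooth fields of symmetric nondegenerate bilinear forms. -/
structure IsSemiRiemannian (g : BilinField E M) : Prop where
  smooth : g.Smooth
  symm : ∀ (x : M) (v w : TangentSpace 𝓘(ℝ, E) x), g x v w = g x w v
  nondegenerate : ∀ (x : M) (v : TangentSpace 𝓘(ℝ, E) x), (∀ w, g x v w = 0) → v = 0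

namespace IsSemiRiemannian

variable {g : BilinField E M}

theorem ext_of_apply (hg : IsSemiRiemannian g) {x : M}
    {A B : TangentSpace 𝓘(ℝ, E) x →L[ℝ] TangentSpace 𝓘(ℝ, E) x}
    (h : ∀ X Z : VField E M, MDiffAt (T% X) x → MDiffAt (T% Z) x →
      2 * g x (A (X x)) (Z x) = 2 * g x (B (X x)) (Z x)) : A = B := by
  ext v
  refine sub_eq_zero.1 (hg.nondegenerate x _ fun w ↦ ?_)
  have := h (FiberBundle.extend E v) (FiberBundle.extend E w)
    (FiberBundle.mdifferentiableAt_extend ..) (FiberBundle.mdifferentiableAt_extend ..)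
  simp at this
  simp [this]

variable [CompleteSpace E]

theorem tensorial_koszul₁ (hg : IsSemiRiemannian g) {Y Z : VField E M} {x : M}
    (hY : MDiffAt (T% Y) x) (hZ : MDiffAt (T% Z) x) :
    TensorialAt 𝓘(ℝ, E) E (fun X ↦ koszul g Y X Z x) x where
  smul {f X} hf hX := by
    have e1 : (fun y ↦ g y ((f • X) y) (Z y)) = fun y ↦ f y * g y (X y) (Z y) := by
      ext y; simp
    have e2 : (fun y ↦ g y ((f • X) y) (Y y)) = fun y ↦ f y * g y (X y) (Y y) := by
      ext y; simp
    simp only [koszul]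
    rw [e1, e2, mvfderiv_fun_mul hf (hg.smooth.mdifferentiableAt hX hZ),
      mvfderiv_fun_mul hf (hg.smooth.mdifferentiableAt hX hY),
      VectorField.mlieBracket_smul_left hf hX, VectorField.mlieBracket_smul_left hf hX]
    simp
    ring
  add {X X'} hX hX' := by
    have e1 : (fun y ↦ g y ((X + X') y) (Z y))
        = fun y ↦ g y (X y) (Z y) + g y (X' y) (Z y) := by
      ext y; simp
    have e2 : (fun y ↦ g y ((X + X') y) (Y y))
        = fun y ↦ g y (X y) (Y y) + g y (X' y) (Y y) := by
      ext y; simp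
    simp only [koszul]
    rw [e1, e2, mvfderiv_fun_add (hg.smooth.mdifferentiableAt hX hZ)
        (hg.smooth.mdifferentiableAt hX' hZ),
      mvfderiv_fun_add (hg.smooth.mdifferentiableAt hX hY)
        (hg.smooth.mdifferentiableAt hX' hY),
      VectorField.mlieBracket_add_left hX hX', VectorField.mlieBracket_add_left hX hX']
    simp
    ring

theorem tensorial_koszul₂ (hg : IsSemiRiemannian g) {Y X : VField E M} {x : M}
    (hY : MDiffAt (T% Y) x) (hX : MDiffAt (T% X) x) :
    TensorialAt 𝓘(ℝ, E) E (fun Z ↦ koszul g Y X Z x) x where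
  smul {f Z} hf hZ := by
    have e1 : (fun y ↦ g y (Y y) ((f • Z) y)) = fun y ↦ f y * g y (Y y) (Z y) := by
      ext y; simp
    have e2 : (fun y ↦ g y (X y) ((f • Z) y)) = fun y ↦ f y * g y (X y) (Z y) := by
      ext y; simp
    simp only [koszul]
    rw [e1, e2, mvfderiv_fun_mul hf (hg.smooth.mdifferentiableAt hY hZ),
      mvfderiv_fun_mul hf (hg.smooth.mdifferentiableAt hX hZ),
      VectorField.mlieBracket_smul_right hf hZ, VectorField.mlieBracket_smul_right hf hZ]
    simp [hg.symm x (Z x)]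
    ring
  add {Z Z'} hZ hZ' := by
    have e1 : (fun y ↦ g y (Y y) ((Z + Z') y))
        = fun y ↦ g y (Y y) (Z y) + g y (Y y) (Z' y) := by
      ext y; simp
    have e2 : (fun y ↦ g y (X y) ((Z + Z') y))
        = fun y ↦ g y (X y) (Z y) + g y (X y) (Z' y) := by
      ext y; simp
    simp only [koszul]
    rw [e1, e2, mvfderiv_fun_add (hg.smooth.mdifferentiableAt hY hZ)
        (hg.smooth.mdifferentiableAt hY hZ'),
      mvfderiv_fun_add (hg.smooth.mdifferentiableAt hX hZ)
        (hg.smooth.mdifferentiableAt hX hZ'),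
      VectorField.mlieBracket_add_right hZ hZ', VectorField.mlieBracket_add_right hZ hZ']
    simp
    ring

variable [FiniteDimensional ℝ E]

set_option linter.unusedSectionVars false

/-- The musical isomorphism `v ↦ g(v, ·)`. -/
def flat (hg : IsSemiRiemannian g) (x : M) :
    TangentSpace 𝓘(ℝ, E) x ≃L[ℝ] (TangentSpace 𝓘(ℝ, E) x →L[ℝ] ℝ) :=
  haveI : FiniteDimensional ℝ (TangentSpace 𝓘(ℝ, E) x) := inferInstanceAs (FiniteDimensional ℝ E)
  haveI : T2Space (TangentSpace 𝓘(ℝ, E) x) := inferInstanceAs (T2Space E)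
  LinearEquiv.toContinuousLinearEquiv <|
    LinearEquiv.ofInjectiveOfFinrankEq (g x : TangentSpace 𝓘(ℝ, E) x →ₗ[ℝ] _)
      ((injective_iff_map_eq_zero _).2 fun v hv ↦ hg.nondegenerate x v fun w ↦ by
        simpa using congr($hv w))
      ((LinearMap.toContinuousLinearMap (𝕜 := ℝ) (E := TangentSpace 𝓘(ℝ, E) x)
        (F' := ℝ)).finrank_eq ▸ (Subspace.dual_finrank_eq).symm)

theorem flat_apply (hg : IsSemiRiemannian g) (x : M) (v w : TangentSpace 𝓘(ℝ, E) x) :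
    hg.flat x v w = g x v w := rfl

theorem apply_flat_symm (hg : IsSemiRiemannian g) (x : M)
    (α : TangentSpace 𝓘(ℝ, E) x →L[ℝ] ℝ) (w : TangentSpace 𝓘(ℝ, E) x) :
    g x ((hg.flat x).symm α) w = α w := by
  rw [← hg.flat_apply, ContinuousLinearEquiv.apply_symm_apply]

/-- The Koszul expression for a fixed differentiable field `Y`, as a bilinear form. -/
def koszulForm (hg : IsSemiRiemannian g) {Y : VField E M} {x : M} (hY : MDiffAt (T% Y) x) :
    TangentSpace 𝓘(ℝ, E) x →L[ℝ] TangentSpace 𝓘(ℝ, E) x →L[ℝ] ℝ :=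
  TensorialAt.mkHom₂ (fun X Z ↦ koszul g Y X Z x) x
    (fun _ hZ ↦ hg.tensorial_koszul₁ hY hZ) (fun _ hX ↦ hg.tensorial_koszul₂ hY hX)

theorem koszulForm_apply (hg : IsSemiRiemannian g) {X Y Z : VField E M} {x : M}
    (hX : MDiffAt (T% X) x) (hY : MDiffAt (T% Y) x) (hZ : MDiffAt (T% Z) x) :
    hg.koszulForm hY (X x) (Z x) = koszul g Y X Z x :=
  TensorialAt.mkHom₂_apply (fun _ hZ ↦ hg.tensorial_koszul₁ hY hZ)
    (fun _ hX ↦ hg.tensorial_koszul₂ hY hX) hX hZ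

open scoped Classical in
/-- The map `Y ↦ (v ↦ ∇_v Y)` given by the Koszul formula `2 g(∇_X Y, Z) = koszul g Y X Z`
(zero where `Y` is not differentiable). -/
def leviCivitaFun (hg : IsSemiRiemannian g) (Y : VField E M) (x : M) :
    TangentSpace 𝓘(ℝ, E) x →L[ℝ] TangentSpace 𝓘(ℝ, E) x :=
  if hY : MDiffAt (T% Y) x then
    ((hg.flat x).symm : _ →L[ℝ] TangentSpace 𝓘(ℝ, E) x) ∘L ((1 / 2 : ℝ) • hg.koszulForm hY)
  else 0

theorem two_mul_apply_leviCivitaFun (hg : IsSemiRiemannian g) {X Y Z : VField E M} {x : M}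
    (hX : MDiffAt (T% X) x) (hY : MDiffAt (T% Y) x) (hZ : MDiffAt (T% Z) x) :
    2 * g x (hg.leviCivitaFun Y x (X x)) (Z x) = koszul g Y X Z x := by
  rw [← hg.koszulForm_apply hX hY hZ, leviCivitaFun, dif_pos hY]
  simp only [ContinuousLinearMap.comp_apply, ContinuousLinearEquiv.coe_coe, apply_flat_symm]
  simp

theorem isCovariantDerivativeOn_leviCivitaFun (hg : IsSemiRiemannian g) :
    IsCovariantDerivativeOn E hg.leviCivitaFun Set.univ where
  add {Y Y' x} hY hY' _ := by
    refine hg.ext_of_apply fun X Z hX hZ ↦ ?_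
    have hYY' : MDiffAt (T% (Y + Y')) x := mdifferentiableAt_add_section hY hY'
    have e1 : (fun y ↦ g y ((Y + Y') y) (Z y))
        = fun y ↦ g y (Y y) (Z y) + g y (Y' y) (Z y) := by
      ext y; simp
    have e2 : (fun y ↦ g y (X y) ((Y + Y') y))
        = fun y ↦ g y (X y) (Y y) + g y (X y) (Y' y) := by
      ext y; simp
    rw [hg.two_mul_apply_leviCivitaFun hX hYY' hZ, add_apply, map_add,
      add_apply, mul_add, hg.two_mul_apply_leviCivitaFun hX hY hZ,
      hg.two_mul_apply_leviCivitaFun hX hY' hZ]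
    simp only [koszul]
    rw [e1, e2, mvfderiv_fun_add (hg.smooth.mdifferentiableAt hY hZ)
        (hg.smooth.mdifferentiableAt hY' hZ),
      mvfderiv_fun_add (hg.smooth.mdifferentiableAt hX hY)
        (hg.smooth.mdifferentiableAt hX hY'),
      VectorField.mlieBracket_add_left hY hY', VectorField.mlieBracket_add_right hY hY']
    simp
    ring
  leibniz {Y f x} hY hf _ := by
    refine hg.ext_of_apply fun X Z hX hZ ↦ ?_
    have hfY : MDiffAt (T% (f • Y)) x := hf.smul_section hY
    have e1 : (fun y ↦ g y ((f • Y) y) (Z y)) = fun y ↦ f y * g y (Y y) (Z y) := by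
      ext y; simp
    have e2 : (fun y ↦ g y (X y) ((f • Y) y)) = fun y ↦ f y * g y (X y) (Y y) := by
      ext y; simp
    have h := hg.two_mul_apply_leviCivitaFun hX hY hZ
    have h' : 2 * g x ((f x • hg.leviCivitaFun Y x + (d% f x).smulRight (Y x)) (X x)) (Z x)
        = f x * (2 * g x (hg.leviCivitaFun Y x (X x)) (Z x))
          + 2 * (d% f x (X x) * g x (Y x) (Z x)) := by
      simp
      ring
    rw [hg.two_mul_apply_leviCivitaFun hX hfY hZ, h', h]
    simp only [koszul]
    rw [e1, e2, mvfderiv_fun_mul hf (hg.smooth.mdifferentiableAt hY hZ),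
      mvfderiv_fun_mul hf (hg.smooth.mdifferentiableAt hX hY),
      VectorField.mlieBracket_smul_left hf hY, VectorField.mlieBracket_smul_right hf hY]
    simp [hg.symm x (X x) (Y x)]
    ring

/-- The Levi-Civita connection of a semi-Riemannian metric. -/
def leviCivita (hg : IsSemiRiemannian g) :
    CovariantDerivative 𝓘(ℝ, E) E (TangentSpace 𝓘(ℝ, E) : M → Type _) where
  toFun := hg.leviCivitaFun
  isCovariantDerivativeOnUniv := hg.isCovariantDerivativeOn_leviCivitaFun

theorem leviCivita_torsion (hg : IsSemiRiemannian g) : hg.leviCivita.torsion = 0 := by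
  rw [CovariantDerivative.torsion_eq_zero_iff]
  intro X Y x hX hY
  refine sub_eq_zero.1 (hg.nondegenerate x _ fun w ↦ ?_)
  have hW := FiberBundle.mdifferentiableAt_extend 𝓘(ℝ, E) E w
  have h1 := hg.two_mul_apply_leviCivitaFun hX hY hW
  have h2 := hg.two_mul_apply_leviCivitaFun hY hX hW
  simp only [koszul, FiberBundle.extend_apply_self] at h1 h2
  have e : (fun y ↦ g y (X y) (Y y)) = fun y ↦ g y (Y y) (X y) := by
    ext y; exact hg.symm y _ _
  rw [VectorField.mlieBracket_swap (V := Y) (W := X)] at h2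
  rw [e] at h1
  simp only [Pi.neg_apply, map_neg, neg_apply] at h2
  change g x (hg.leviCivitaFun Y x (X x) - hg.leviCivitaFun X x (Y x) - _) w = 0
  simp only [map_sub, sub_apply]
  linarith

theorem leviCivita_metric (hg : IsSemiRiemannian g) {X Y Z : VField E M} {x : M}
    (hX : MDiffAt (T% X) x) (hY : MDiffAt (T% Y) x) (hZ : MDiffAt (T% Z) x) :
    d% (fun y ↦ g y (Y y) (Z y)) x (X x)
      = g x (hg.leviCivita Y x (X x)) (Z x) + g x (Y x) (hg.leviCivita Z x (X x)) := by
  have h1 := hg.two_mul_apply_leviCivitaFun hX hY hZ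
  have h2 := hg.two_mul_apply_leviCivitaFun hX hZ hY
  change _ = g x (hg.leviCivitaFun Y x (X x)) (Z x) + g x (Y x) (hg.leviCivitaFun Z x (X x))
  rw [hg.symm x (Y x)]
  simp only [koszul] at h1 h2
  have e : (fun y ↦ g y (Z y) (Y y)) = fun y ↦ g y (Y y) (Z y) := by
    ext y; exact hg.symm y _ _
  rw [VectorField.mlieBracket_swap (V := Z) (W := Y), e] at h2
  simp only [Pi.neg_apply, map_neg, neg_apply] at h2
  linarith

end IsSemiRiemannian
end LeviCivita

section Connection

variable {E : Type*} [NormedAddCommGroup E] [NormedSpace ℝ E]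
  {M : Type*} [TopologicalSpace M] [ChartedSpace E M] [IsManifold 𝓘(ℝ, E) ∞ M]

/-- The curvature `R(X,Y)Z = ∇_X ∇_Y Z - ∇_Y ∇_X Z - ∇_[X,Y] Z` of an affine connection.
In Mathlib's convention `cov Z x v` is `∇_v Z`. -/
def affineCurvature (cov : CovariantDerivative 𝓘(ℝ, E) E (TangentSpace 𝓘(ℝ, E) : M → Type _))
    (X Y Z : VField E M) : VField E M := fun x ↦
  cov (fun y ↦ cov Z y (Y y)) x (X x) - cov (fun y ↦ cov Z y (X y)) x (Y x)
    - cov Z x (VectorField.mlieBracket 𝓘(ℝ, E) X Y x)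

/-- The curvature of the connection vanishes at every point `x`, on all vector fields
that are `C^∞` at `x`. -/
def IsFlatConnection
    (cov : CovariantDerivative 𝓘(ℝ, E) E (TangentSpace 𝓘(ℝ, E) : M → Type _)) : Prop :=
  ∀ (x : M) (X Y Z : VField E M), CMDiffAt ∞ (T% X) x → CMDiffAt ∞ (T% Y) x →
    CMDiffAt ∞ (T% Z) x → affineCurvature cov X Y Z x = 0

end Connection

section Paracontact

variable {E : Type*} [NormedAddCommGroup E] [NormedSpace ℝ E]
  {M : Type*} [TopologicalSpace M] [ChartedSpace E M]

/-- The exterior derivative of a one-form, with the normalization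
`2 dη(X,Y) = X(η(Y)) - Y(η(X)) - η([X,Y])`. -/
def extDerivForm (η : CovField E M) (X Y : VField E M) (x : M) : ℝ :=
  (d% (fun y ↦ η y (Y y)) x (X x) - d% (fun y ↦ η y (X y)) x (Y x)
    - η x (VectorField.mlieBracket 𝓘(ℝ, E) X Y x)) / 2

/-- The Nijenhuis tensor
`N_ψ(X,Y) = ψ²[X,Y] + [ψX,ψY] - ψ[ψX,Y] - ψ[X,ψY]`. -/
def nijenhuis (ψ : EndField E M) (X Y : VField E M) (x : M) : TangentSpace 𝓘(ℝ, E) x :=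
  ψ x (ψ x (VectorField.mlieBracket 𝓘(ℝ, E) X Y x))
    + VectorField.mlieBracket 𝓘(ℝ, E) (fun y ↦ ψ y (X y)) (fun y ↦ ψ y (Y y)) x
    - ψ x (VectorField.mlieBracket 𝓘(ℝ, E) (fun y ↦ ψ y (X y)) Y x)
    - ψ x (VectorField.mlieBracket 𝓘(ℝ, E) X (fun y ↦ ψ y (Y y)) x)

variable (E M) in
/-- The tensor fields `(ψ, ξ, η, g)` entering a paracontact metric structure, without conditions. -/
structure ParacontactTensors where
  ψ : EndField E M
  ξ : VField E M
  η : CovField E M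
  g : BilinField E M

variable [IsManifold 𝓘(ℝ, E) ∞ M]

namespace ParacontactTensors

/-- The eigenspace of `ψ_x` restricted to `𝒟_x = ker η_x` for the eigenvalue `c`. -/
def eigenDistribution (S : ParacontactTensors E M) (c : ℝ) (x : M) :
    Submodule ℝ (TangentSpace 𝓘(ℝ, E) x) :=
  LinearMap.ker (S.η x : TangentSpace 𝓘(ℝ, E) x →ₗ[ℝ] ℝ) ⊓
    Module.End.eigenspace (S.ψ x : TangentSpace 𝓘(ℝ, E) x →ₗ[ℝ] TangentSpace 𝓘(ℝ, E) x) c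

/-- `(ψ, ξ, η)` is an almost paracontact structure on the `(2n+1)`-dimensional manifold `M`. -/
structure IsAlmostParacontact (n : ℕ) (S : ParacontactTensors E M) : Prop where
  smooth_ψ : S.ψ.Smooth
  smooth_ξ : S.ξ.Smooth
  smooth_η : S.η.Smooth
  η_ξ : ∀ x, S.η x (S.ξ x) = 1
  ψ_sq : ∀ (x : M) (v : TangentSpace 𝓘(ℝ, E) x), S.ψ x (S.ψ x v) = v - S.η x v • S.ξ x
  finrank_pos : ∀ x, Module.finrank ℝ (S.eigenDistribution 1 x) = n
  finrank_neg : ∀ x, Module.finrank ℝ (S.eigenDistribution (-1) x) = n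

/-- `(ψ, ξ, η, g)` is a paracontact metric structure: `g` is a compatible semi-Riemannian metric
with `dη(X,Y) = g(X, ψY)`. -/
structure IsParacontactMetric (n : ℕ) (S : ParacontactTensors E M) : Prop
    extends IsAlmostParacontact n S where
  metric : IsSemiRiemannian S.g
  compatible : ∀ (x : M) (v w : TangentSpace 𝓘(ℝ, E) x),
    S.g x (S.ψ x v) (S.ψ x w) = - S.g x v w + S.η x v * S.η x w
  contact : ∀ (x : M) (X Y : VField E M), MDiffAt (T% X) x → MDiffAt (T% Y) x →
    extDerivForm S.η X Y x = S.g x (X x) (S.ψ x (Y x))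

/-- A para-Sasakian structure is a paracontact metric structure that is normal:
`N_ψ - 2 dη ⊗ ξ = 0`. -/
structure IsParaSasakian (n : ℕ) (S : ParacontactTensors E M) : Prop
    extends IsParacontactMetric n S where
  normal : ∀ (x : M) (X Y : VField E M), MDiffAt (T% X) x → MDiffAt (T% Y) x →
    nijenhuis S.ψ X Y x - (2 * extDerivForm S.η X Y x) • S.ξ x = 0

namespace IsAlmostParacontact

variable [CompleteSpace E] {n : ℕ} {S : ParacontactTensors E M}

theorem tensorial_lieDeriv (hS : IsAlmostParacontact n S) (x : M) :
    TensorialAt 𝓘(ℝ, E) E (fun X : VField E M ↦ (1 / 2 : ℝ) •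
      (VectorField.mlieBracket 𝓘(ℝ, E) S.ξ (fun y ↦ S.ψ y (X y)) x
        - S.ψ x (VectorField.mlieBracket 𝓘(ℝ, E) S.ξ X x))) x where
  smul {f X} hf hX := by
    have e : (fun y ↦ S.ψ y ((f • X) y)) = f • fun y ↦ S.ψ y (X y) := by
      ext y; simp
    rw [e, VectorField.mlieBracket_smul_right hf (hS.smooth_ψ.mdifferentiableAt hX),
      VectorField.mlieBracket_smul_right hf hX]
    simp
    module
  add {X X'} hX hX' := by
    have e : (fun y ↦ S.ψ y ((X + X') y)) = (fun y ↦ S.ψ y (X y)) + fun y ↦ S.ψ y (X' y) := by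
      ext y; simp
    rw [e, VectorField.mlieBracket_add_right (hS.smooth_ψ.mdifferentiableAt hX)
      (hS.smooth_ψ.mdifferentiableAt hX'), VectorField.mlieBracket_add_right hX hX']
    simp
    module

variable [FiniteDimensional ℝ E]

/-- The operator `h = ½ 𝓛_ξ ψ`, that is, `hX = ½ ([ξ, ψX] - ψ[ξ, X])`. -/
def h (hS : IsAlmostParacontact n S) : EndField E M := fun x ↦
  TensorialAt.mkHom _ x (hS.tensorial_lieDeriv x)

theorem h_apply (hS : IsAlmostParacontact n S) {X : VField E M} {x : M}
    (hX : MDiffAt (T% X) x) :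
    hS.h x (X x) = (1 / 2 : ℝ) •
      (VectorField.mlieBracket 𝓘(ℝ, E) S.ξ (fun y ↦ S.ψ y (X y)) x
        - S.ψ x (VectorField.mlieBracket 𝓘(ℝ, E) S.ξ X x)) :=
  TensorialAt.mkHom_apply (hS.tensorial_lieDeriv x) hX

end IsAlmostParacontact

namespace IsParacontactMetric

variable [CompleteSpace E] [FiniteDimensional ℝ E] {n : ℕ} {S : ParacontactTensors E M}

/-- The tensor `(Y, X) ↦ η(X) ψY + η(Y) (ψX - ψhX) + g(X - hX, ψY) ξ`. -/
def connectionTensor (hS : IsParacontactMetric n S) (x : M) :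
    TangentSpace 𝓘(ℝ, E) x →L[ℝ] TangentSpace 𝓘(ℝ, E) x →L[ℝ] TangentSpace 𝓘(ℝ, E) x :=
  haveI : FiniteDimensional ℝ (TangentSpace 𝓘(ℝ, E) x) := inferInstanceAs (FiniteDimensional ℝ E)
  haveI : T2Space (TangentSpace 𝓘(ℝ, E) x) := inferInstanceAs (T2Space E)
  (LinearMap.mk₂ ℝ
    (fun Y X : TangentSpace 𝓘(ℝ, E) x ↦
      S.η x X • S.ψ x Y + S.η x Y • (S.ψ x X - S.ψ x (hS.h x X))
        + S.g x (X - hS.h x X) (S.ψ x Y) • S.ξ x)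
    (by intros; simp; module) (by intros; simp; module)
    (by intros; simp; module) (by intros; simp; module)).toContinuousBilinearMap

theorem connectionTensor_apply (hS : IsParacontactMetric n S) (x : M)
    (Y X : TangentSpace 𝓘(ℝ, E) x) :
    hS.connectionTensor x Y X =
      S.η x X • S.ψ x Y + S.η x Y • (S.ψ x X - S.ψ x (hS.h x X))
        + S.g x (X - hS.h x X) (S.ψ x Y) • S.ξ x := rfl

/-- The canonical paracontact connection
`∇^pc_X Y = ∇_X Y + η(X) ψY + η(Y) (ψX - ψhX) + g(X - hX, ψY) ξ`,
where `∇` is the Levi-Civita connection of `g`. -/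
def canonicalConnection (hS : IsParacontactMetric n S) :
    CovariantDerivative 𝓘(ℝ, E) E (TangentSpace 𝓘(ℝ, E) : M → Type _) :=
  hS.metric.leviCivita.addOneForm hS.connectionTensor

theorem canonicalConnection_apply (hS : IsParacontactMetric n S) (X Y : VField E M) (x : M) :
    hS.canonicalConnection Y x (X x) = hS.metric.leviCivita Y x (X x)
      + S.η x (X x) • S.ψ x (Y x) + S.η x (Y x) • (S.ψ x (X x) - S.ψ x (hS.h x (X x)))
      + S.g x (X x - hS.h x (X x)) (S.ψ x (Y x)) • S.ξ x := by
  change hS.metric.leviCivita Y x (X x) + hS.connectionTensor x (Y x) (X x) = _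
  rw [connectionTensor_apply]
  module

end IsParacontactMetric

/-- `S` on `M` and `S'` on `M'` are locally isomorphic: every point of `M` has an open neighbourhood
that is mapped diffeomorphically onto an open subset of `M'` by a map carrying `(ψ, ξ, η, g)`
to `(ψ', ξ', η', g')`. -/
def LocallyIsomorphic (S : ParacontactTensors E M)
    {E' : Type*} [NormedAddCommGroup E'] [NormedSpace ℝ E']
    {M' : Type*} [TopologicalSpace M'] [ChartedSpace E' M'] [IsManifold 𝓘(ℝ, E') ∞ M']
    (S' : ParacontactTensors E' M') : Prop :=
  ∀ p : M, ∃ Φ : OpenPartialHomeomorph M M', p ∈ Φ.source ∧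
    ContMDiffOn 𝓘(ℝ, E) 𝓘(ℝ, E') ∞ Φ Φ.source ∧
    ContMDiffOn 𝓘(ℝ, E') 𝓘(ℝ, E) ∞ Φ.symm Φ.target ∧
    ∀ q ∈ Φ.source,
      (∀ v, mfderiv 𝓘(ℝ, E) 𝓘(ℝ, E') Φ q (S.ψ q v)
        = S'.ψ (Φ q) (mfderiv 𝓘(ℝ, E) 𝓘(ℝ, E') Φ q v)) ∧
      mfderiv 𝓘(ℝ, E) 𝓘(ℝ, E') Φ q (S.ξ q) = S'.ξ (Φ q) ∧
      (∀ v, S'.η (Φ q) (mfderiv 𝓘(ℝ, E) 𝓘(ℝ, E') Φ q v) = S.η q v) ∧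
      (∀ v w, S'.g (Φ q) (mfderiv 𝓘(ℝ, E) 𝓘(ℝ, E') Φ q v)
        (mfderiv 𝓘(ℝ, E) 𝓘(ℝ, E') Φ q w) = S.g q v w)

end ParacontactTensors

end Paracontact

section Standard

/-- `ℝ^{2n+1}` with global coordinates `(x_1, …, x_n, y_1, …, y_n, z)`. -/
abbrev CoordSpace (n : ℕ) : Type := (Fin n → ℝ) × (Fin n → ℝ) × ℝ

/-- The usual smooth structure of `ℝ^{2n+1}`, with the identity as its chart. -/
instance CoordSpace.chartedSpace (n : ℕ) : ChartedSpace (CoordSpace n) (CoordSpace n) :=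
  chartedSpaceSelf _

/-- The one-form `dz - ∑ y_i dx_i` at the point `p = (x, y, z)`. -/
def stdForm (n : ℕ) (p : CoordSpace n) : CoordSpace n →L[ℝ] ℝ :=
  LinearMap.toContinuousLinearMap
    { toFun := fun v ↦ v.2.2 - ∑ i, p.2.1 i * v.1 i
      map_add' := fun v w ↦ by simp [mul_add, Finset.sum_add_distrib]; ring
      map_smul' := fun c v ↦ by simp [mul_sub, Finset.mul_sum, mul_left_comm] }

/-- The endomorphism with `∂/∂x_i ↦ -∂/∂x_i - y_i ∂/∂z`, `∂/∂y_i ↦ ∂/∂y_i`, `∂/∂z ↦ 0`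
at the point `p = (x, y, z)`. -/
def stdEnd (n : ℕ) (p : CoordSpace n) : CoordSpace n →L[ℝ] CoordSpace n :=
  LinearMap.toContinuousLinearMap
    { toFun := fun v ↦ (-v.1, v.2.1, -∑ i, p.2.1 i * v.1 i)
      map_add' := fun v w ↦ by simp [mul_add, Finset.sum_add_distrib]; constructor <;> abel
      map_smul' := fun c v ↦ by simp [Finset.mul_sum, mul_left_comm] }

/-- The bilinear form `η ⊗ η + ½ ∑ (dx_i ⊗ dy_i + dy_i ⊗ dx_i)` at the point `p = (x, y, z)`; its
matrix has the blocks `(y_i y_j, ½ δ_ij, -y_i; ½ δ_ij, 0, 0; -y_j, 0, 1)`. -/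
def stdMetric (n : ℕ) (p : CoordSpace n) : CoordSpace n →L[ℝ] CoordSpace n →L[ℝ] ℝ :=
  (LinearMap.mk₂ ℝ
    (fun v w : CoordSpace n ↦ stdForm n p v * stdForm n p w
      + (1 / 2) * ∑ i, (v.1 i * w.2.1 i + v.2.1 i * w.1 i))
    (by intros; simp [add_mul, mul_add, Finset.sum_add_distrib]; ring)
    (by intros; simp [Finset.mul_sum, Finset.sum_add_distrib, mul_add, mul_left_comm, mul_assoc])
    (by intros; simp [mul_add, Finset.sum_add_distrib]; ring)
    (by intros; simp [Finset.mul_sum, Finset.sum_add_distrib, mul_add, mul_left_comm])).toContinuousBilinearMap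

/-- The standard para-Sasakian structure on `ℝ^{2n+1}`, with `ξ = ∂/∂z`. -/
def stdParaSasakian (n : ℕ) : ParacontactTensors (CoordSpace n) (CoordSpace n) where
  ψ := stdEnd n
  ξ := fun _ ↦ ((0, 0, 1) : CoordSpace n)
  η := stdForm n
  g := stdMetric n

end Standard

end

/-!
The canonical connection of a para-Sasakian manifold parallelizes `ψ`, `η` and `g`, and its torsion
is the tensor `2 dη ⊗ ξ`. If it is flat, parallel frames therefore have constant structure
functions, namely those of the left-invariant frame of the hyperbolic Heisenberg group, and the
frame dual to such a frame can be integrated to coordinates in which the structure is the standard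
one.

In detail: normality gives `h = 0` (`ParacontactTensors.IsParaSasakian.h_eq_zero`). In a chart the
structure becomes a para-Sasakian structure on an open subset of a vector space
(`ParacontactTensors.IsParaSasakian.isParaSasakianOn`), the canonical connection becomes
`canonicalChristoffel` (`ParacontactTensors.IsParaSasakian.canonicalConnection_chartLift`), and its
curvature becomes that of these symbols (`IsFlatConnection.isFlatOn`). Pointwise algebra
(`IsParacontactAlgebra.covDeriv_ξ_eq` and `IsParacontactAlgebra.covDeriv_ψ_eq`) then yields
`∇_X ξ = -ψX` and `(∇_X ψ)Y = η(Y)X - g(X, Y)ξ` for the Levi-Civita connection, which says that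
`η`, `ψ` and `g` are parallel for the canonical connection.

A flat connection has parallel transport near every point (`IsFlatOn.exists_parallel`). The partial
differential equation behind this is a flat total differential system, which is solved along rays;
that the result solves the full system is a Grönwall estimate (`hasFDerivAt_of_radial_solution`).
Transporting a frame `eᵢ ∈ 𝒟₋`, `fᵢ ∈ 𝒟₊` with `g(eᵢ, fⱼ) = ½ δᵢⱼ` gives a parallel frame of the
same kind (`IsParaSasakianOn.exists_parallel_frame`). As the torsion is a multiple of `ξ`, the forms
`2g(fᵢ, ·)` and `2g(eᵢ, ·)` are closed; their primitives `xᵢ` and `yᵢ` satisfy `dη = ∑ dxᵢ ∧ dyᵢ` up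
to normalization, so that `η + ∑ yᵢ dxᵢ` is closed and has a primitive `z`. The map `(x, y, z)` is
the required isomorphism (`IsParaSasakianOn.exists_normal_form`).
-/

noncomputable section

/-! ### Flat linear total differential systems -/

section TotalDifferential

set_option maxSynthPendingDepth 3

open Metric Set

variable {E : Type*} [NormedAddCommGroup E] [NormedSpace ℝ E]
  {F : Type*} [NormedAddCommGroup F] [NormedSpace ℝ F]

/-- Uniform first- and second-order Taylor bounds for a `C²` function near a point. -/
theorem ContDiffOn.exists_taylor_bounds {G : E → F} {U : Set E} (hU : IsOpen U) {x₀ : E}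
    (hx₀ : x₀ ∈ U) (hG : ContDiffOn ℝ 2 G U) :
    ∃ r > 0, ∃ C > 0, ball x₀ r ⊆ U ∧ (∀ x ∈ ball x₀ r, ‖G x‖ ≤ C) ∧
      (∀ x ∈ ball x₀ r, ‖fderiv ℝ G x‖ ≤ C) ∧
      (∀ x ∈ ball x₀ r, ∀ y ∈ ball x₀ r, ‖G y - G x‖ ≤ C * ‖y - x‖) ∧
      ∀ x ∈ ball x₀ r, ∀ y ∈ ball x₀ r,
        ‖G y - G x - fderiv ℝ G x (y - x)‖ ≤ C * ‖y - x‖ ^ 2 := by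
  have hG1 : ContDiffOn ℝ 1 (fderiv ℝ G) U := hG.fderiv_of_isOpen hU (by norm_num)
  obtain ⟨K, t, ht, hK⟩ := (hG1.contDiffAt (hU.mem_nhds hx₀)).exists_lipschitzOnWith
  have e1 : ∀ᶠ x in 𝓝 x₀, ‖G x‖ < ‖G x₀‖ + 1 :=
    ((hG.contDiffAt (hU.mem_nhds hx₀)).continuousAt.norm).eventually_lt_const (by linarith)
  have e2 : ∀ᶠ x in 𝓝 x₀, ‖fderiv ℝ G x‖ < ‖fderiv ℝ G x₀‖ + 1 :=
    ((hG1.contDiffAt (hU.mem_nhds hx₀)).continuousAt.norm).eventually_lt_const (by linarith)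
  obtain ⟨r, hr, hball⟩ := Metric.eventually_nhds_iff_ball.1
    (((hU.eventually_mem hx₀).and (Filter.eventually_mem_set.2 ht)).and (e1.and e2))
  have hd : ∀ x ∈ ball x₀ r, HasFDerivAt G (fderiv ℝ G x) x := fun x hx ↦
    ((hG.differentiableOn (by norm_num)).differentiableAt
      (hU.mem_nhds (hball x hx).1.1)).hasFDerivAt
  refine ⟨r, hr, max (‖G x₀‖ + 1) (max (‖fderiv ℝ G x₀‖ + 1) K), by positivity,
    fun x hx ↦ (hball x hx).1.1, fun x hx ↦ (hball x hx).2.1.le.trans (le_max_left _ _),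
    fun x hx ↦ (hball x hx).2.2.le.trans ((le_max_left _ _).trans (le_max_right _ _)), ?_, ?_⟩
  · intro x hx y hy
    refine (convex_ball x₀ r).norm_image_sub_le_of_norm_hasFDerivWithin_le
      (fun z hz ↦ (hd z hz).hasFDerivWithinAt) (fun z hz ↦ ?_) hx hy
    exact (hball z hz).2.2.le.trans ((le_max_left _ _).trans (le_max_right _ _))
  · intro x hx y hy
    have h1 : ‖G y - G x - fderiv ℝ G x (y - x)‖ ≤ (K * ‖y - x‖) * ‖y - x‖ := by
      refine ((convex_ball x₀ r).inter
        (convex_closedBall x ‖y - x‖)).norm_image_sub_le_of_norm_hasFDerivWithin_le'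
        (fun z hz ↦ (hd z hz.1).hasFDerivWithinAt) (fun z hz ↦ ?_) ⟨hx, by simp⟩
        ⟨hy, by simp [dist_eq_norm]⟩
      have := hK.dist_le_mul z (hball z hz.1).1.2 x (hball x hx).1.2
      rw [dist_eq_norm, dist_eq_norm] at this
      refine this.trans ?_
      have := hz.2
      rw [mem_closedBall, dist_eq_norm] at this
      gcongr
    refine h1.trans ?_
    rw [mul_assoc, ← sq]
    gcongr
    exact (le_max_right _ _).trans (le_max_right _ _)

/-- The algebraic heart of `hasFDerivAt_of_radial_solution`: if `Y` solves the system along the ray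
in direction `s`, then the first-order variation `Y + t G(Y)h` solves it along the ray in direction
`s + h` up to an error which is quadratic in `h`. Flatness of the system enters through `hflat`. -/
theorem norm_radial_residual_le {C M t : ℝ} (hC : 0 < C) (ht0 : 0 ≤ t) (ht1 : t ≤ 1)
    {G G' : F →L[ℝ] E →L[ℝ] F} {D : E →L[ℝ] F →L[ℝ] E →L[ℝ] F} {s h : E} {Y : F}
    (hY : ‖Y‖ ≤ M) (hsh : ‖s + h‖ ≤ 1) (hG : ‖G‖ ≤ C) (hD : ‖D‖ ≤ C)
    (h1 : ‖G' - G‖ ≤ C * ‖t • h‖) (h2 : ‖G' - G - D (t • h)‖ ≤ C * ‖t • h‖ ^ 2)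
    (hflat : D s Y h + G (G Y s) h = D h Y s + G (G Y h) s) :
    ‖(G Y s + (G Y h + t • (D s Y h + G (G Y s) h))) - G' (Y + t • G Y h) (s + h)‖
      ≤ (2 * C * M + 2 * C * C * M) * ‖h‖ ^ 2 := by
  have hM : 0 ≤ M := (norm_nonneg _).trans hY
  have hth : ‖t • h‖ ≤ ‖h‖ := by
    rw [norm_smul, Real.norm_of_nonneg ht0]
    exact mul_le_of_le_one_left (norm_nonneg _) ht1
  -- The terms of order at most one in `h` cancel, by flatness.
  have hsplit : (G Y s + (G Y h + t • (D s Y h + G (G Y s) h))) - G' (Y + t • G Y h) (s + h)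
      = -((G' - G - D (t • h)) Y (s + h) + t • D h Y h + t • (G' - G) (G Y h) (s + h)
        + t • G (G Y h) h) := by
    rw [hflat]
    simp only [map_add, map_smul, sub_apply, add_apply, smul_apply, smul_add]
    module
  have hW : ‖G Y h‖ ≤ C * M * ‖h‖ := by
    refine (G.le_opNorm₂ Y h).trans ?_
    gcongr
  have b1 : ‖(G' - G - D (t • h)) Y (s + h)‖ ≤ C * M * ‖h‖ ^ 2 := by
    refine ((G' - G - D (t • h)).le_opNorm₂ Y (s + h)).trans ?_
    calc ‖G' - G - D (t • h)‖ * ‖Y‖ * ‖s + h‖ ≤ (C * ‖h‖ ^ 2) * M * 1 := by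
          gcongr
          exact h2.trans (by gcongr)
      _ = _ := by ring
  have b2 : ‖t • D h Y h‖ ≤ C * M * ‖h‖ ^ 2 := by
    rw [norm_smul, Real.norm_of_nonneg ht0]
    refine (mul_le_of_le_one_left (norm_nonneg _) ht1).trans (((D h).le_opNorm₂ Y h).trans ?_)
    calc ‖D h‖ * ‖Y‖ * ‖h‖ ≤ (C * ‖h‖) * M * ‖h‖ := by
          gcongr
          exact (D.le_opNorm h).trans (by gcongr)
      _ = _ := by ring
  have b3 : ‖t • (G' - G) (G Y h) (s + h)‖ ≤ C * C * M * ‖h‖ ^ 2 := by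
    rw [norm_smul, Real.norm_of_nonneg ht0]
    refine (mul_le_of_le_one_left (norm_nonneg _) ht1).trans
      (((G' - G).le_opNorm₂ (G Y h) (s + h)).trans ?_)
    calc ‖G' - G‖ * ‖G Y h‖ * ‖s + h‖ ≤ (C * ‖h‖) * (C * M * ‖h‖) * 1 := by
          gcongr
          exact h1.trans (by gcongr)
      _ = _ := by ring
  have b4 : ‖t • G (G Y h) h‖ ≤ C * C * M * ‖h‖ ^ 2 := by
    rw [norm_smul, Real.norm_of_nonneg ht0]
    refine (mul_le_of_le_one_left (norm_nonneg _) ht1).trans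
      ((G.le_opNorm₂ (G Y h) h).trans ?_)
    calc ‖G‖ * ‖G Y h‖ * ‖h‖ ≤ C * (C * M * ‖h‖) * ‖h‖ := by gcongr
      _ = _ := by ring
  rw [hsplit, norm_neg]
  refine (norm_add_le _ _).trans ?_
  have := norm_add_le ((G' - G - D (t • h)) Y (s + h) + t • D h Y h) (t • (G' - G) (G Y h) (s + h))
  have := norm_add_le ((G' - G - D (t • h)) Y (s + h)) (t • D h Y h)
  linarith

/-- A family of solutions along the rays from `x₀` of a flat total differential system
`DY = G(x)(Y)`: its endpoint map solves the full system. -/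
theorem hasFDerivAt_of_radial_solution {G : E → F →L[ℝ] E →L[ℝ] F} {x₀ : E} {r C : ℝ}
    (hC : 0 < C) (hr1 : r ≤ 1)
    (hd : ∀ x ∈ ball x₀ r, HasFDerivAt G (fderiv ℝ G x) x)
    (hb : ∀ x ∈ ball x₀ r, ‖G x‖ ≤ C) (hb' : ∀ x ∈ ball x₀ r, ‖fderiv ℝ G x‖ ≤ C)
    (h1 : ∀ x ∈ ball x₀ r, ∀ y ∈ ball x₀ r, ‖G y - G x‖ ≤ C * ‖y - x‖)
    (h2 : ∀ x ∈ ball x₀ r, ∀ y ∈ ball x₀ r,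
      ‖G y - G x - fderiv ℝ G x (y - x)‖ ≤ C * ‖y - x‖ ^ 2)
    (hflat : ∀ x ∈ ball x₀ r, ∀ (Y : F) (u w : E),
      fderiv ℝ G x u Y w + G x (G x Y u) w = fderiv ℝ G x w Y u + G x (G x Y w) u)
    {Y₀ : F} {α : E → ℝ → F} (hα0 : ∀ x ∈ ball x₀ r, α x 0 = Y₀)
    (hα : ∀ x ∈ ball x₀ r, ∀ t ∈ Icc (0 : ℝ) 1,
      HasDerivWithinAt (α x) (G (x₀ + t • (x - x₀)) (α x t) (x - x₀)) (Icc 0 1) t)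
    {x : E} (hx : x ∈ ball x₀ r) :
    HasFDerivAt (fun y ↦ α y 1) (G x (α x 1)) x := by
  have hray : ∀ y ∈ ball x₀ r, ∀ t ∈ Icc (0 : ℝ) 1, x₀ + t • (y - x₀) ∈ ball x₀ r := by
    intro y hy t ht
    rw [mem_ball, dist_eq_norm] at hy ⊢
    rw [add_sub_cancel_left, norm_smul, Real.norm_of_nonneg ht.1]
    exact (mul_le_of_le_one_left (norm_nonneg _) ht.2).trans_lt hy
  have hnorm : ∀ y ∈ ball x₀ r, ‖y - x₀‖ ≤ 1 := fun y hy ↦ by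
    rw [mem_ball, dist_eq_norm] at hy; linarith
  have hαc : ∀ y ∈ ball x₀ r, ContinuousOn (α y) (Icc 0 1) := fun y hy t ht ↦
    (hα y hy t ht).continuousWithinAt
  obtain ⟨M, hM⟩ := isCompact_Icc.exists_bound_of_continuousOn (hαc x hx)
  set s := x - x₀ with hs
  set ε : ℝ := 2 * C * M + 2 * C * C * M with hε
  have key : ∀ h : E, x + h ∈ ball x₀ r →
      ‖α (x + h) 1 - α x 1 - G x (α x 1) h‖ ≤ ε * gronwallBound 0 C 1 1 * ‖h‖ ^ 2 := by
    intro h hxh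
    have hsh : x + h - x₀ = s + h := by rw [hs]; abel
    -- The first-order variation in the direction `h`, an approximate solution along the ray to
    -- `x + h`.
    have hZ : ∀ t ∈ Icc (0 : ℝ) 1, HasDerivWithinAt
        (fun t : ℝ ↦ α x t + t • G (x₀ + t • s) (α x t) h)
        (G (x₀ + t • s) (α x t) s + (G (x₀ + t • s) (α x t) h
          + t • (fderiv ℝ G (x₀ + t • s) s (α x t) h
            + G (x₀ + t • s) (G (x₀ + t • s) (α x t) s) h))) (Icc 0 1) t := by
      intro t ht
      have hline : HasDerivWithinAt (fun t : ℝ ↦ x₀ + t • s) s (Icc 0 1) t := by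
        simpa using ((hasDerivWithinAt_id t (Icc 0 1)).smul_const s).const_add x₀
      have hGl := (hd _ (hray x hx t ht)).comp_hasDerivWithinAt t hline
      have := (hα x hx t ht).add ((hasDerivWithinAt_id t (Icc 0 1)).smul
        ((hGl.clm_apply (hα x hx t ht)).clm_apply (hasDerivWithinAt_const t (Icc 0 1) h)))
      refine this.congr_deriv ?_
      simp only [← hs, id, Function.comp_apply, map_zero, add_zero, add_apply, one_smul]
      abel
    -- The vector field is clamped to times in `[0, 1]`, since it has to be Lipschitz for all times.
    have hgron := dist_le_of_approx_trajectories_ODE (K := C.toNNReal) (a := 0) (b := 1)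
      (v := fun t Y ↦ G (x₀ + (max 0 (min t 1)) • (x + h - x₀)) Y (x + h - x₀))
      (f := fun t : ℝ ↦ α x t + t • G (x₀ + t • s) (α x t) h) (g := α (x + h))
      (εf := ε * ‖h‖ ^ 2) (εg := 0) (δ := 0)
      (fun t ↦ by
        refine LipschitzWith.of_dist_le_mul fun Y Y' ↦ ?_
        have ht : max 0 (min t 1) ∈ Icc (0 : ℝ) 1 := ⟨le_max_left _ _, by simp⟩
        rw [dist_eq_norm, dist_eq_norm, ← sub_apply, ← map_sub]
        refine ((G _).le_opNorm₂ _ _).trans ?_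
        calc _ ≤ C * ‖Y - Y'‖ * 1 := by
              gcongr
              · exact hb _ (hray _ hxh _ ht)
              · exact hnorm _ hxh
          _ = _ := by simp [hC.le])
      (fun t ht ↦ (hZ t ht).continuousWithinAt)
      (fun t ht ↦ ((hZ t ⟨ht.1, ht.2.le⟩).mono_of_mem_nhdsWithin
        (Icc_mem_nhdsGE_of_mem ht)))
      (fun t ht ↦ by
        have ht' : t ∈ Icc (0 : ℝ) 1 := ⟨ht.1, ht.2.le⟩
        have hd0 : x₀ + t • (s + h) - (x₀ + t • s) = t • h := by module
        have hz := hray x hx t ht'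
        have hz' := hray (x + h) hxh t ht'
        rw [hsh] at hz'
        rw [dist_eq_norm, min_eq_left ht'.2, max_eq_right ht'.1, hsh]
        refine norm_radial_residual_le hC ht'.1 ht'.2 (hM t ht') ?_ (hb _ hz) (hb' _ hz) ?_ ?_
          (hflat _ hz _ _ _)
        · rw [← hsh]; exact hnorm _ hxh
        · have := h1 _ hz _ hz'
          rwa [hd0] at this
        · have := h2 _ hz _ hz'
          rwa [hd0] at this)
      (hαc _ hxh)
      (fun t ht ↦ ((hα _ hxh t ⟨ht.1, ht.2.le⟩).mono_of_mem_nhdsWithin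
        (Icc_mem_nhdsGE_of_mem ht)))
      (fun t ht ↦ by simp [min_eq_left ht.2.le, max_eq_right ht.1])
      (by simp [hα0 _ hx, hα0 _ hxh]) 1 ⟨zero_le_one, le_rfl⟩
    have hlin : gronwallBound 0 C (ε * ‖h‖ ^ 2 + 0) (1 - 0)
        = ε * gronwallBound 0 C 1 1 * ‖h‖ ^ 2 := by
      rw [gronwallBound_of_K_ne_0 hC.ne', gronwallBound_of_K_ne_0 hC.ne']
      simp
      ring
    rw [Real.coe_toNNReal _ hC.le, hlin, dist_comm, dist_eq_norm] at hgron
    have hxs : x₀ + (1 : ℝ) • s = x := by rw [hs]; module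
    rw [hxs, one_smul] at hgron
    rwa [sub_sub]
  rw [hasFDerivAt_iff_isLittleO_nhds_zero]
  have hO : (fun h : E ↦ α (x + h) 1 - α x 1 - G x (α x 1) h) =O[𝓝 0] fun h ↦ ‖h‖ ^ 2 := by
    refine Asymptotics.IsBigO.of_bound (ε * gronwallBound 0 C 1 1) ?_
    have : ∀ᶠ h : E in 𝓝 0, x + h ∈ ball x₀ r := by
      have hc : ContinuousAt (fun h : E ↦ x + h) 0 := by fun_prop
      exact hc.eventually_mem (isOpen_ball.mem_nhds (by simpa using hx))
    filter_upwards [this] with h hh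
    simpa using key h hh
  exact hO.trans_isLittleO (Asymptotics.isLittleO_norm_pow_id one_lt_two)

/-- A flat (formally integrable) linear total differential system `DY = G(x)(Y)` has local
solutions with prescribed value at a point. -/
theorem exists_forall_hasFDerivAt_of_flat [CompleteSpace F] {U : Set E} (hU : IsOpen U) {x₀ : E}
    (hx₀ : x₀ ∈ U) {G : E → F →L[ℝ] E →L[ℝ] F} (hG : ContDiffOn ℝ 2 G U)
    (hflat : ∀ x ∈ U, ∀ (Y : F) (u w : E),
      fderiv ℝ G x u Y w + G x (G x Y u) w = fderiv ℝ G x w Y u + G x (G x Y w) u) (Y₀ : F) :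
    ∃ r > 0, ball x₀ r ⊆ U ∧ ∃ Y : E → F, Y x₀ = Y₀ ∧
      ∀ x ∈ ball x₀ r, HasFDerivAt Y (G x (Y x)) x := by
  obtain ⟨R, hR, C, hC, hsub, hb, hb', h1, h2⟩ := hG.exists_taylor_bounds hU hx₀
  -- On a ball of this radius the Picard-Lindelöf time along every ray is at least `1`.
  set r : ℝ := min R (min 1 (1 / (C * (‖Y₀‖ + 1)))) with hr
  have hr0 : 0 < r := by positivity
  have hrR : ball x₀ r ⊆ ball x₀ R := ball_subset_ball (min_le_left _ _)
  have hray : ∀ y ∈ ball x₀ r, ∀ t ∈ Icc (0 : ℝ) 1, x₀ + t • (y - x₀) ∈ ball x₀ R := by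
    intro y hy t ht
    refine hrR ?_
    rw [mem_ball, dist_eq_norm] at hy ⊢
    rw [add_sub_cancel_left, norm_smul, Real.norm_of_nonneg ht.1]
    exact (mul_le_of_le_one_left (norm_nonneg _) ht.2).trans_lt hy
  have hd : ∀ x ∈ ball x₀ R, HasFDerivAt G (fderiv ℝ G x) x := fun x hx ↦
    ((hG.differentiableOn (by norm_num)).differentiableAt (hU.mem_nhds (hsub hx))).hasFDerivAt
  have hex : ∀ x ∈ ball x₀ r, ∃ α : ℝ → F, α 0 = Y₀ ∧ ∀ t ∈ Icc (0 : ℝ) 1,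
      HasDerivWithinAt α (G (x₀ + t • (x - x₀)) (α t) (x - x₀)) (Icc 0 1) t := by
    intro x hx
    have hxr : ‖x - x₀‖ < r := by rwa [mem_ball, dist_eq_norm] at hx
    have hpl : IsPicardLindelof (fun (t : ℝ) Y ↦ G (x₀ + t • (x - x₀)) Y (x - x₀))
        (tmin := 0) (tmax := 1) ⟨0, le_rfl, zero_le_one⟩ Y₀ 1 0 1 C.toNNReal := by
      refine ⟨fun t ht ↦ LipschitzOnWith.of_dist_le_mul fun Y _ Y' _ ↦ ?_, fun Y _ t ht ↦ ?_,
        fun t ht Y hY ↦ ?_, by simp⟩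
      · rw [dist_eq_norm, dist_eq_norm, ← sub_apply, ← map_sub]
        refine ((G _).le_opNorm₂ _ _).trans ?_
        calc _ ≤ C * ‖Y - Y'‖ * 1 := by
              gcongr
              · exact hb _ (hray _ hx _ ht)
              · exact hxr.le.trans ((min_le_right _ _).trans (min_le_left _ _))
          _ = _ := by simp [hC.le]
      · have hGc : ContinuousAt G (x₀ + t • (x - x₀)) := (hd _ (hray x hx t ht)).continuousAt
        have : ContinuousAt (fun t : ℝ ↦ G (x₀ + t • (x - x₀))) t :=
          ContinuousAt.comp (f := fun t : ℝ ↦ x₀ + t • (x - x₀)) hGc (by fun_prop)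
        exact ((this.clm_apply continuousAt_const).clm_apply
          continuousAt_const).continuousWithinAt
      · have hYn : ‖Y‖ ≤ ‖Y₀‖ + 1 := by
          have : ‖Y - Y₀‖ ≤ 1 := by simpa [dist_eq_norm] using hY
          have := norm_add_le (Y - Y₀) Y₀
          rw [sub_add_cancel] at this
          linarith
        refine ((G _).le_opNorm₂ _ _).trans ?_
        calc _ ≤ C * (‖Y₀‖ + 1) * (1 / (C * (‖Y₀‖ + 1))) := by
              gcongr
              · exact hb _ (hray _ hx _ ht)
              · exact hxr.le.trans ((min_le_right _ _).trans (min_le_right _ _))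
          _ = 1 := by field_simp
          _ = _ := by simp
    simpa using hpl.exists_eq_forall_mem_Icc_hasDerivWithinAt₀
  choose! α hα0 hα using hex
  have hx₀r : x₀ ∈ ball x₀ r := mem_ball_self hr0
  refine ⟨r, hr0, hrR.trans hsub, fun x ↦ α x 1, ?_, fun x hx ↦ ?_⟩
  · -- Along the constant ray the solution is constant.
    have hz : ∀ t ∈ Icc (0 : ℝ) 1, HasDerivWithinAt (α x₀) 0 (Icc 0 1) t := fun t ht ↦ by
      simpa using hα x₀ hx₀r t ht
    have := (convex_Icc (0 : ℝ) 1).norm_image_sub_le_of_norm_hasDerivWithin_le (C := 0) hz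
      (by simp) (left_mem_Icc.2 zero_le_one) (right_mem_Icc.2 zero_le_one)
    rw [zero_mul, norm_le_zero_iff, sub_eq_zero, hα0 x₀ hx₀r] at this
    exact this
  · exact hasFDerivAt_of_radial_solution hC ((min_le_right _ _).trans (min_le_left _ _))
      (fun x hx ↦ hd x (hrR hx)) (fun x hx ↦ hb x (hrR hx)) (fun x hx ↦ hb' x (hrR hx))
      (fun x hx y hy ↦ h1 x (hrR hx) y (hrR hy)) (fun x hx y hy ↦ h2 x (hrR hx) y (hrR hy))
      (fun x hx ↦ hflat x (hsub (hrR hx))) hα0 hα hx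

end TotalDifferential

/-! ### Pointwise algebra of paracontact metric structures -/

/-- The pointwise axioms of a paracontact metric structure, on a single (tangent) space. -/
structure IsParacontactAlgebra {V : Type*} [AddCommGroup V] [Module ℝ V] [TopologicalSpace V]
    [IsTopologicalAddGroup V] [ContinuousSMul ℝ V]
    (ψ : V →L[ℝ] V) (ξ : V) (η : V →L[ℝ] ℝ) (g : V →L[ℝ] V →L[ℝ] ℝ) : Prop where
  η_ξ : η ξ = 1
  ψ_sq : ∀ v, ψ (ψ v) = v - η v • ξ
  symm : ∀ v w, g v w = g w v
  nondegenerate : ∀ v, (∀ w, g v w = 0) → v = 0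
  compatible : ∀ v w, g (ψ v) (ψ w) = -g v w + η v * η w

namespace IsParacontactAlgebra

variable {V : Type*} [AddCommGroup V] [Module ℝ V] [TopologicalSpace V]
  [IsTopologicalAddGroup V] [ContinuousSMul ℝ V]
  {ψ : V →L[ℝ] V} {ξ : V} {η : V →L[ℝ] ℝ} {g : V →L[ℝ] V →L[ℝ] ℝ}

theorem ext_left (H : IsParacontactAlgebra ψ ξ η g) {v w : V} (h : ∀ u, g v u = g w u) : v = w :=
  sub_eq_zero.1 (H.nondegenerate _ fun u ↦ by simp [h u])

theorem ψ_ξ (H : IsParacontactAlgebra ψ ξ η g) : ψ ξ = 0 := by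
  have e1 : ψ (ψ ξ) = 0 := by simp [H.ψ_sq, H.η_ξ]
  have e2 : ψ ξ = η (ψ ξ) • ξ := by
    have := H.ψ_sq (ψ ξ)
    rw [e1, map_zero] at this
    exact sub_eq_zero.1 this.symm
  have e3 : η (ψ ξ) • (η (ψ ξ) • ξ) = 0 := by
    rw [← e2, ← map_smul, ← e2, e1]
  have e4 : η (ψ ξ) * η (ψ ξ) = 0 := by
    have := congrArg η e3
    simpa [H.η_ξ] using this
  rw [e2, mul_self_eq_zero.1 e4, zero_smul]

theorem η_ψ (H : IsParacontactAlgebra ψ ξ η g) (v : V) : η (ψ v) = 0 := by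
  have h1 : ψ (ψ (ψ v)) = ψ v - η (ψ v) • ξ := H.ψ_sq _
  have h2 : ψ (ψ (ψ v)) = ψ v := by rw [H.ψ_sq v]; simp [H.ψ_ξ]
  have := congrArg η (h2.symm.trans h1)
  simp only [map_sub, map_smul, H.η_ξ, smul_eq_mul] at this
  linarith

theorem g_ξ (H : IsParacontactAlgebra ψ ξ η g) (v : V) : g ξ v = η v := by
  have := H.compatible ξ v
  rw [H.ψ_ξ, H.η_ξ, map_zero, zero_apply] at this
  linarith

theorem g_ψ_left (H : IsParacontactAlgebra ψ ξ η g) (v w : V) : g (ψ v) w = -g v (ψ w) := by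
  have := H.compatible v (ψ w)
  rw [H.ψ_sq, map_sub, map_smul, H.symm (ψ v) ξ, H.g_ξ, H.η_ψ, H.η_ψ] at this
  simpa using this

/-- On a paracontact metric structure, let `K` stand for `∇ξ` and `P` for `∇ψ`. The first-order
identities satisfied by a normal structure (`skew` from `∇g = 0`, `cyclic` from `d(dη) = 0`,
`normal` from `N_ψ = 2 dη ⊗ ξ`, `P_ξ` from `ψξ = 0`, `contact` from `dη = g(·, ψ·)`, `K_ξ` from
`g(ξ, ξ) = 1`) force `∇ξ = -ψ`, that is, `ξ` is Killing. -/
theorem covDeriv_ξ_eq (H : IsParacontactAlgebra ψ ξ η g) {P : V → V → V} {K : V →L[ℝ] V}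
    (P_zero : ∀ v, P 0 v = 0)
    (skew : ∀ u v w, g (P u v) w + g v (P u w) = 0)
    (cyclic : ∀ u v w, g v (P u w) + g w (P v u) + g u (P w v) = 0)
    (normal : ∀ u v, P (ψ u) v - P (ψ v) u + ψ (P v u) - ψ (P u v) = (2 * g u (ψ v)) • ξ)
    (P_ξ : ∀ u, P u ξ = -ψ (K u))
    (contact : ∀ u v, g (K u) v - g (K v) u = 2 * g u (ψ v))
    (K_ξ : ∀ u, g (K u) ξ = 0) (u : V) : K u = -ψ u := by
  have hKξ : K ξ = 0 := H.nondegenerate _ fun w ↦ by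
    have := contact w ξ
    rw [K_ξ, H.ψ_ξ, map_zero] at this
    linarith
  have hηK : ∀ u, η (K u) = 0 := fun u ↦ by rw [← H.g_ξ, H.symm, K_ξ]
  -- Normality with second argument `ξ` makes `g(K·, ·)` skew on the image of `ψ`.
  have hskewψ : ∀ x z, g (K (ψ x)) (ψ z) + g (K (ψ z)) (ψ x) = 0 := by
    intro x z
    have h1 := congrArg (g · z) (normal x ξ)
    simp only [P_ξ, H.ψ_ξ, P_zero, sub_zero, map_zero, mul_zero, zero_smul, map_neg, map_add,
      map_sub, H.ψ_sq, hηK, zero_smul, sub_zero, zero_apply, add_apply, neg_apply, sub_apply,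
      H.g_ψ_left] at h1
    have h2 := cyclic ξ (ψ z) x
    rw [P_ξ, H.symm (ψ z), map_neg, H.symm x, H.g_ψ_left] at h2
    have h3 := skew x ξ (ψ z)
    rw [P_ξ, map_neg, neg_apply, H.compatible, hηK] at h3
    linarith
  have hskew : ∀ x z, g (K x) z + g (K z) x = 0 := by
    intro x z
    have := hskewψ (ψ x) (ψ z)
    simpa [H.ψ_sq, hKξ, K_ξ] using this
  -- Being skew, `g(K·, ·)` is half of its antisymmetrization, which is known from `contact`.
  refine H.ext_left fun w ↦ ?_
  have := contact u w
  have := hskew u w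
  rw [map_neg, neg_apply, H.g_ψ_left]
  linarith

/-- The pointwise form of the characterization `(∇_X ψ)Y = η(Y)X - g(X, Y)ξ` of para-Sasakian
structures; see `covDeriv_ξ_eq` for the meaning of the hypotheses, in which `∇ξ = -ψ` has been
inserted; `sq` comes from `ψ² = I - η ⊗ ξ`. Lowered with `g`, the difference of the two sides is
a trilinear form with enough symmetries to vanish. -/
theorem covDeriv_ψ_eq (H : IsParacontactAlgebra ψ ξ η g) {P : V → V → V}
    (skew : ∀ u v w, g (P u v) w + g v (P u w) = 0)
    (cyclic : ∀ u v w, g v (P u w) + g w (P v u) + g u (P w v) = 0)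
    (normal : ∀ u v, P (ψ u) v - P (ψ v) u + ψ (P v u) - ψ (P u v) = (2 * g u (ψ v)) • ξ)
    (P_ξ : ∀ u, P u ξ = ψ (ψ u))
    (sq : ∀ u v, P u (ψ v) + ψ (P u v) = g (ψ u) v • ξ + η v • ψ u) (u v : V) :
    P u v = η v • u - g u v • ξ := by
  set S : V → V → V → ℝ := fun u v w ↦ g (P u v) w - η v * g u w + g u v * η w with hS
  have Sskew : ∀ u v w, S u v w = -S u w v := fun u v w ↦ by
    have := skew u v w
    rw [H.symm v] at this
    simp only [hS]
    linarith
  have Scyc : ∀ u v w, S u w v + S v u w + S w v u = 0 := fun u v w ↦ by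
    have := cyclic u v w
    rw [H.symm v, H.symm w, H.symm u] at this
    simp only [hS]
    linear_combination this + η v * (H.symm u w) + η w * (H.symm v u) + η u * (H.symm w v)
  have Sψ : ∀ u v w, S u (ψ v) w = S u v (ψ w) := fun u v w ↦ by
    have h := congrArg (g · w) (sq u v)
    simp only [map_add, map_smul, add_apply, smul_apply, H.g_ψ_left, H.g_ξ, smul_eq_mul] at h
    simp only [hS, H.η_ψ]
    linear_combination h
  have Snormal : ∀ x y z, S (ψ x) y z - S (ψ y) x z - S y x (ψ z) + S x y (ψ z) = 0 := by
    intro x y z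
    have h := congrArg (g · z) (normal x y)
    simp only [map_add, map_sub, map_smul, add_apply, sub_apply, smul_apply, H.g_ψ_left, H.g_ξ,
      smul_eq_mul] at h
    have := H.symm y (ψ x)
    simp only [hS, H.η_ψ, H.g_ψ_left] at this ⊢
    linear_combination h + η z * this
  -- The cyclic identity moves `ψ` out of the first slot in `Snormal`.
  have Sz : ∀ x y z, S z x (ψ y) = 0 := fun x y z ↦ by
    have h1 := Snormal x y z
    have h2 := Scyc (ψ x) z y
    have h3 := Scyc (ψ y) z x
    rw [Sψ z x y, ← Sψ y z x, Sskew y (ψ z) x] at h2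
    rw [Sskew z (ψ y) x, ← Sψ x z y, Sskew x (ψ z) y] at h3
    linarith
  have Sξ : ∀ x z, S z x ξ = 0 := fun x z ↦ by
    rw [Sskew]
    simp only [hS, P_ξ, H.ψ_sq, H.η_ξ, map_sub, map_smul, sub_apply, smul_apply, H.g_ξ,
      H.symm z ξ, smul_eq_mul]
    ring
  refine H.ext_left fun w ↦ ?_
  -- `S` vanishes on the image of `ψ` and on `ξ` in its last slot, and these span.
  have h0 : S u v w = 0 := by
    have h1 := Sz v (ψ w) u
    have h2 := Sξ v u
    rw [H.ψ_sq] at h1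
    simp only [hS, map_sub, map_smul, smul_eq_mul, H.η_ξ] at h1 h2 ⊢
    linear_combination h1 + η w * h2
  simp only [hS] at h0
  simp only [map_sub, map_smul, sub_apply, smul_apply, smul_eq_mul, H.g_ξ]
  linarith

end IsParacontactAlgebra

/-! ### Para-Sasakian structures on open subsets of a vector space -/

section Christoffel

set_option maxSynthPendingDepth 3

variable {E : Type*} [NormedAddCommGroup E] [NormedSpace ℝ E]

theorem hasFDerivAt_of_contDiffOn {F : Type*} [NormedAddCommGroup F] [NormedSpace ℝ F] {f : E → F}
    {U : Set E} {x : E} (hU : IsOpen U) (hf : ContDiffOn ℝ ∞ f U) (hx : x ∈ U) :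
    HasFDerivAt f (fderiv ℝ f x) x :=
  ((hf.differentiableOn (by simp)).differentiableAt (hU.mem_nhds hx)).hasFDerivAt

theorem fderiv_unique_of_eqOn {F : Type*} [NormedAddCommGroup F] [NormedSpace ℝ F] {f₁ f₂ : E → F}
    {f₁' f₂' : E →L[ℝ] F} {U : Set E} {x : E} (hU : IsOpen U) (hx : x ∈ U)
    (h₁ : HasFDerivAt f₁ f₁' x) (h₂ : HasFDerivAt f₂ f₂' x) (h : ∀ y ∈ U, f₁ y = f₂ y)
    (u : E) : f₁' u = f₂' u := by
  have : f₁ =ᶠ[𝓝 x] f₂ := Filter.eventually_of_mem (hU.mem_nhds hx) h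
  rw [(h₁.congr_of_eventuallyEq this.symm).unique h₂]

/-- A para-Sasakian structure on an open subset `U` of a vector space, with the contact and
normality conditions evaluated on constant vector fields. By `contact`, `2 dη ⊗ ξ` in the normality
condition is `2 g(·, ψ·) ξ`. -/
structure IsParaSasakianOn (U : Set E) (ψ : E → E →L[ℝ] E) (ξ : E → E) (η : E → E →L[ℝ] ℝ)
    (g : E → E →L[ℝ] E →L[ℝ] ℝ) : Prop where
  isOpen : IsOpen U
  smooth_ψ : ContDiffOn ℝ ∞ ψ U
  smooth_ξ : ContDiffOn ℝ ∞ ξ U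
  smooth_η : ContDiffOn ℝ ∞ η U
  smooth_g : ContDiffOn ℝ ∞ g U
  algebra : ∀ x ∈ U, IsParacontactAlgebra (ψ x) (ξ x) (η x) (g x)
  contact : ∀ x ∈ U, ∀ u v, fderiv ℝ η x u v - fderiv ℝ η x v u = 2 * g x u (ψ x v)
  normal : ∀ x ∈ U, ∀ u v, fderiv ℝ ψ x (ψ x u) v - fderiv ℝ ψ x (ψ x v) u
    + ψ x (fderiv ℝ ψ x v u) - ψ x (fderiv ℝ ψ x u v) = (2 * g x u (ψ x v)) • ξ x

namespace IsParaSasakianOn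

variable {U : Set E} {ψ : E → E →L[ℝ] E} {ξ : E → E} {η : E → E →L[ℝ] ℝ}
  {g : E → E →L[ℝ] E →L[ℝ] ℝ} {x : E}

variable (H : IsParaSasakianOn U ψ ξ η g) (hx : x ∈ U)
include H hx

theorem hasFDerivAt_ψ : HasFDerivAt ψ (fderiv ℝ ψ x) x :=
  hasFDerivAt_of_contDiffOn H.isOpen H.smooth_ψ hx

theorem hasFDerivAt_ξ : HasFDerivAt ξ (fderiv ℝ ξ x) x :=
  hasFDerivAt_of_contDiffOn H.isOpen H.smooth_ξ hx

theorem hasFDerivAt_η : HasFDerivAt η (fderiv ℝ η x) x :=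
  hasFDerivAt_of_contDiffOn H.isOpen H.smooth_η hx

theorem hasFDerivAt_g : HasFDerivAt g (fderiv ℝ g x) x :=
  hasFDerivAt_of_contDiffOn H.isOpen H.smooth_g hx

theorem fderiv_g_symm (u v w : E) : fderiv ℝ g x u v w = fderiv ℝ g x u w v := by
  have h : ∀ v w, HasFDerivAt (fun y ↦ g y v w) _ x := fun v w ↦
    ((H.hasFDerivAt_g hx).clm_apply (hasFDerivAt_const v x)).clm_apply (hasFDerivAt_const w x)
  simpa using fderiv_unique_of_eqOn H.isOpen hx (h v w) (h w v)
    (fun y hy ↦ (H.algebra y hy).symm v w) u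

/-- The derivative of `ψ² = I - η ⊗ ξ`. -/
theorem fderiv_ψ_sq (u v : E) : fderiv ℝ ψ x u (ψ x v) + ψ x (fderiv ℝ ψ x u v)
    = -(fderiv ℝ η x u v • ξ x + η x v • fderiv ℝ ξ x u) := by
  have h1 := (H.hasFDerivAt_ψ hx).clm_apply
    ((H.hasFDerivAt_ψ hx).clm_apply (hasFDerivAt_const v x))
  have h2 := (hasFDerivAt_const v x).sub
    (((H.hasFDerivAt_η hx).clm_apply (hasFDerivAt_const v x)).smul (H.hasFDerivAt_ξ hx))
  have := fderiv_unique_of_eqOn H.isOpen hx h1 h2 (fun y hy ↦ (H.algebra y hy).ψ_sq v) u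
  simp at this
  rw [add_comm, this]
  abel

/-- The derivative of the skew-symmetry `g(ψ·, ·) = -g(·, ψ·)`. -/
theorem fderiv_g_ψ (u v w : E) : fderiv ℝ g x u (ψ x v) w + g x (fderiv ℝ ψ x u v) w
    = -(fderiv ℝ g x u v (ψ x w) + g x v (fderiv ℝ ψ x u w)) := by
  have h1 := ((H.hasFDerivAt_g hx).clm_apply
    ((H.hasFDerivAt_ψ hx).clm_apply (hasFDerivAt_const v x))).clm_apply (hasFDerivAt_const w x)
  have h2 := (((H.hasFDerivAt_g hx).clm_apply (hasFDerivAt_const v x)).clm_apply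
    ((H.hasFDerivAt_ψ hx).clm_apply (hasFDerivAt_const w x))).neg
  have := fderiv_unique_of_eqOn H.isOpen hx h1 h2 (fun y hy ↦ (H.algebra y hy).g_ψ_left v w) u
  simp at this
  linarith

theorem fderiv_ψ_ξ (u : E) : fderiv ℝ ψ x u (ξ x) + ψ x (fderiv ℝ ξ x u) = 0 := by
  have h1 := (H.hasFDerivAt_ψ hx).clm_apply (H.hasFDerivAt_ξ hx)
  have := fderiv_unique_of_eqOn H.isOpen hx h1 (hasFDerivAt_const 0 x)
    (fun y hy ↦ (H.algebra y hy).ψ_ξ) u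
  simpa [add_comm] using this

/-- The derivative of `η = g(ξ, ·)`. -/
theorem fderiv_η_eq (u v : E) :
    fderiv ℝ η x u v = fderiv ℝ g x u (ξ x) v + g x (fderiv ℝ ξ x u) v := by
  have h1 := ((H.hasFDerivAt_g hx).clm_apply (H.hasFDerivAt_ξ hx)).clm_apply
    (hasFDerivAt_const v x)
  have h2 := (H.hasFDerivAt_η hx).clm_apply (hasFDerivAt_const v x)
  have := fderiv_unique_of_eqOn H.isOpen hx h1 h2 (fun y hy ↦ (H.algebra y hy).g_ξ v) u
  simp at this
  linarith

theorem fderiv_g_ξ_ξ (u : E) : fderiv ℝ g x u (ξ x) (ξ x) + 2 * g x (fderiv ℝ ξ x u) (ξ x) = 0 := by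
  have h1 := ((H.hasFDerivAt_g hx).clm_apply (H.hasFDerivAt_ξ hx)).clm_apply (H.hasFDerivAt_ξ hx)
  have := fderiv_unique_of_eqOn H.isOpen hx h1 (hasFDerivAt_const 1 x)
    (fun y hy ↦ by rw [(H.algebra y hy).g_ξ, (H.algebra y hy).η_ξ]) u
  have h2 := (H.algebra x hx).symm (ξ x) (fderiv ℝ ξ x u)
  simp at this
  linarith

/-- The fundamental form `g(·, ψ·) = dη` is closed. -/
theorem cyclic_fderiv_g_ψ (u v w : E) :
    (fderiv ℝ g x u v (ψ x w) + g x v (fderiv ℝ ψ x u w))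
      + (fderiv ℝ g x v w (ψ x u) + g x w (fderiv ℝ ψ x v u))
      + (fderiv ℝ g x w u (ψ x v) + g x u (fderiv ℝ ψ x w v)) = 0 := by
  have hη' : HasFDerivAt (fderiv ℝ η) (fderiv ℝ (fderiv ℝ η) x) x :=
    hasFDerivAt_of_contDiffOn H.isOpen (H.smooth_η.fderiv_of_isOpen H.isOpen (by simp)) hx
  have hsymm : ∀ a b c : E, fderiv ℝ (fderiv ℝ η) x a b c = fderiv ℝ (fderiv ℝ η) x b a c := by
    intro a b c
    have : IsSymmSndFDerivAt ℝ η x :=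
      (H.smooth_η.contDiffAt (H.isOpen.mem_nhds hx)).isSymmSndFDerivAt
        (by simpa using ENat.LEInfty.out)
    rw [this a b]
  have key : ∀ a b c : E, fderiv ℝ (fderiv ℝ η) x a b c - fderiv ℝ (fderiv ℝ η) x a c b
      = 2 * (fderiv ℝ g x a b (ψ x c) + g x b (fderiv ℝ ψ x a c)) := by
    intro a b c
    have h0 : ∀ b c : E, HasFDerivAt (fun y ↦ fderiv ℝ η y b c) _ x := fun b c ↦
      (hη'.clm_apply (hasFDerivAt_const b x)).clm_apply (hasFDerivAt_const c x)
    have h2 := (((H.hasFDerivAt_g hx).clm_apply (hasFDerivAt_const b x)).clm_apply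
      ((H.hasFDerivAt_ψ hx).clm_apply (hasFDerivAt_const c x))).const_mul 2
    have := fderiv_unique_of_eqOn H.isOpen hx ((h0 b c).sub (h0 c b)) h2
      (fun y hy ↦ H.contact y hy b c) a
    simp at this
    linarith
  have k1 := key u v w
  have k2 := key v w u
  have k3 := key w u v
  linarith [hsymm u v w, hsymm v w u, hsymm w u v]

end IsParaSasakianOn

/-- The covector `w ↦ g'(u)(v,w) + g'(v)(u,w) - g'(w)(u,v)` of the Koszul formula for constant
fields. -/
def koszulCovector (g' : E →L[ℝ] E →L[ℝ] E →L[ℝ] ℝ) (u v : E) : E →L[ℝ] ℝ :=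
  g' u v + g' v u - (g'.flip u).flip v

theorem koszulCovector_apply (g' : E →L[ℝ] E →L[ℝ] E →L[ℝ] ℝ) (u v w : E) :
    koszulCovector g' u v w = g' u v w + g' v u w - g' w u v := rfl

variable [FiniteDimensional ℝ E]

/-- The Christoffel symbols of a metric `g` on a vector space: `christoffel g x u v` is the
Levi-Civita derivative at `x` of the constant field `v` in the direction `u`. -/
def christoffel (g : E → E →L[ℝ] E →L[ℝ] ℝ) (x : E) : E →L[ℝ] E →L[ℝ] E :=
  (LinearMap.mk₂ ℝ (fun u v : E ↦ (g x).inverse ((1 / 2 : ℝ) • koszulCovector (fderiv ℝ g x) u v))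
    (by
      intros
      rw [← map_add, ← smul_add]
      congr 2
      ext
      simp only [koszulCovector_apply, map_add, add_apply]
      ring)
    (by
      intros
      rw [← map_smul, smul_comm]
      congr 2
      ext
      simp only [koszulCovector_apply, map_smul, smul_apply, smul_eq_mul]
      ring)
    (by
      intros
      rw [← map_add, ← smul_add]
      congr 2
      ext
      simp only [koszulCovector_apply, map_add, add_apply]
      ring)
    (by
      intros
      rw [← map_smul, smul_comm]
      congr 2
      ext
      simp only [koszulCovector_apply, map_smul, smul_apply, smul_eq_mul]
      ring)).toContinuousBilinearMap

theorem christoffel_apply (g : E → E →L[ℝ] E →L[ℝ] ℝ) (x u v : E) :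
    christoffel g x u v = (g x).inverse ((1 / 2 : ℝ) • koszulCovector (fderiv ℝ g x) u v) := rfl

theorem isInvertible_of_nondegenerate {b : E →L[ℝ] E →L[ℝ] ℝ}
    (hb : ∀ v, (∀ w, b v w = 0) → v = 0) : b.IsInvertible :=
  ⟨LinearEquiv.toContinuousLinearEquiv <|
    LinearEquiv.ofInjectiveOfFinrankEq (b : E →ₗ[ℝ] _)
      ((injective_iff_map_eq_zero _).2 fun v hv ↦ hb v fun w ↦ by
        simpa using congr($hv w))
      ((LinearMap.toContinuousLinearMap (𝕜 := ℝ) (E := E) (F' := ℝ)).finrank_eq ▸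
        (Subspace.dual_finrank_eq).symm), by ext; rfl⟩

theorem two_mul_apply_christoffel {g : E → E →L[ℝ] E →L[ℝ] ℝ} {x : E}
    (hg : ∀ v, (∀ w, g x v w = 0) → v = 0) (u v w : E) :
    2 * g x (christoffel g x u v) w
      = fderiv ℝ g x u v w + fderiv ℝ g x v u w - fderiv ℝ g x w u v := by
  obtain ⟨e, he⟩ := isInvertible_of_nondegenerate hg
  have : g x (christoffel g x u v) = (1 / 2 : ℝ) • koszulCovector (fderiv ℝ g x) u v := by
    rw [christoffel_apply, ← he, ContinuousLinearMap.inverse_equiv]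
    simp
  rw [this, smul_apply, koszulCovector_apply, smul_eq_mul]
  ring

theorem contDiffOn_christoffel {g : E → E →L[ℝ] E →L[ℝ] ℝ} {U : Set E} (hU : IsOpen U)
    (hg : ContDiffOn ℝ ∞ g U) (hnd : ∀ x ∈ U, ∀ v, (∀ w, g x v w = 0) → v = 0) :
    ContDiffOn ℝ ∞ (christoffel g) U := by
  have hg' : ContDiffOn ℝ ∞ (fderiv ℝ g) U := hg.fderiv_of_isOpen hU (by simp)
  have hinv : ContDiffOn ℝ ∞ (fun x ↦ (g x).inverse) U := fun x hx ↦
    (((isInvertible_of_nondegenerate (hnd x hx)).contDiffAt_map_inverse.comp x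
      (hg.contDiffAt (hU.mem_nhds hx)))).contDiffWithinAt
  refine contDiffOn_clm_apply.2 fun u ↦ contDiffOn_clm_apply.2 fun v ↦ ?_
  simp only [christoffel_apply]
  refine hinv.clm_apply (ContDiffOn.const_smul _ ?_)
  refine contDiffOn_clm_apply.2 fun w ↦ ?_
  simp only [koszulCovector_apply]
  have h3 : ∀ a b c : E, ContDiffOn ℝ ∞ (fun x ↦ fderiv ℝ g x a b c) U := fun a b c ↦
    ((hg'.clm_apply contDiffOn_const).clm_apply contDiffOn_const).clm_apply contDiffOn_const
  exact ((h3 u v w).add (h3 v u w)).sub (h3 w u v)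

/-- The symbols of the canonical paracontact connection when `h = 0`:
`(u, v) ↦ Γ(u, v) + η(u) ψv + η(v) ψu + g(u, ψv) ξ`, where `u` is the direction of differentiation
and `v` the differentiated constant field. -/
def canonicalChristoffel (ψ : E → E →L[ℝ] E) (ξ : E → E) (η : E → E →L[ℝ] ℝ)
    (g : E → E →L[ℝ] E →L[ℝ] ℝ) (x : E) : E →L[ℝ] E →L[ℝ] E :=
  (LinearMap.mk₂ ℝ (fun u v : E ↦ christoffel g x u v + η x u • ψ x v + η x v • ψ x u
      + g x u (ψ x v) • ξ x)
    (by intros; simp; module) (by intros; simp; module)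
    (by intros; simp; module) (by intros; simp; module)).toContinuousBilinearMap

theorem canonicalChristoffel_apply (ψ : E → E →L[ℝ] E) (ξ : E → E) (η : E → E →L[ℝ] ℝ)
    (g : E → E →L[ℝ] E →L[ℝ] ℝ) (x u v : E) :
    canonicalChristoffel ψ ξ η g x u v = christoffel g x u v + η x u • ψ x v + η x v • ψ x u
      + g x u (ψ x v) • ξ x := rfl

namespace IsParaSasakianOn

variable {U : Set E} {ψ : E → E →L[ℝ] E} {ξ : E → E} {η : E → E →L[ℝ] ℝ}
  {g : E → E →L[ℝ] E →L[ℝ] ℝ} {x : E} (H : IsParaSasakianOn U ψ ξ η g) (hx : x ∈ U)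
include H hx

theorem two_mul_g_christoffel (u v w : E) :
    2 * g x (christoffel g x u v) w
      = fderiv ℝ g x u v w + fderiv ℝ g x v u w - fderiv ℝ g x w u v :=
  two_mul_apply_christoffel (H.algebra x hx).nondegenerate u v w

theorem christoffel_symm (u v : E) : christoffel g x u v = christoffel g x v u := by
  refine (H.algebra x hx).ext_left fun w ↦ ?_
  have h1 := H.two_mul_g_christoffel hx u v w
  have h2 := H.two_mul_g_christoffel hx v u w
  have h3 := H.fderiv_g_symm hx w u v
  linarith

theorem fderiv_g_eq_christoffel (u v w : E) : fderiv ℝ g x u v w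
    = g x (christoffel g x u v) w + g x v (christoffel g x u w) := by
  have h1 := H.two_mul_g_christoffel hx u v w
  have h2 := H.two_mul_g_christoffel hx u w v
  rw [(H.algebra x hx).symm v]
  have h3 := H.fderiv_g_symm hx u v w
  have h4 := H.fderiv_g_symm hx v u w
  have h5 := H.fderiv_g_symm hx w u v
  linarith

/-- The Levi-Civita derivatives of `ξ` and `ψ`: `∇_u ξ = -ψu` and
`(∇_u ψ)v = η(v)u - g(u, v)ξ`. -/
theorem leviCivita_derivatives :
    (∀ u, fderiv ℝ ξ x u + christoffel g x u (ξ x) = -ψ x u) ∧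
    ∀ u v, fderiv ℝ ψ x u v + christoffel g x u (ψ x v) - ψ x (christoffel g x u v)
      = η x v • u - g x u v • ξ x := by
  have A := H.algebra x hx
  -- The covariant derivatives `∇ψ` and `∇ξ`, to which the pointwise algebra is applied.
  set P : E → E → E := fun u v ↦
    fderiv ℝ ψ x u v + christoffel g x u (ψ x v) - ψ x (christoffel g x u v) with hP
  set K : E →L[ℝ] E := fderiv ℝ ξ x + (christoffel g x).flip (ξ x) with hK
  have K_apply : ∀ u, K u = fderiv ℝ ξ x u + christoffel g x u (ξ x) := fun u ↦ rfl
  have hη : ∀ u v, fderiv ℝ η x u v = g x (K u) v + η x (christoffel g x u v) := fun u v ↦ by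
    rw [H.fderiv_η_eq hx, H.fderiv_g_eq_christoffel hx, A.g_ξ, K_apply, map_add, add_apply]
    ring
  have skew : ∀ u v w, g x (P u v) w + g x v (P u w) = 0 := fun u v w ↦ by
    have h := H.fderiv_g_ψ hx u v w
    rw [H.fderiv_g_eq_christoffel hx, H.fderiv_g_eq_christoffel hx] at h
    simp only [hP, map_add, map_sub, add_apply, sub_apply, A.g_ψ_left] at h ⊢
    have h2 := A.g_ψ_left v (christoffel g x u w)
    linarith
  have cyclic : ∀ u v w, g x v (P u w) + g x w (P v u) + g x u (P w v) = 0 := fun u v w ↦ by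
    have h := H.cyclic_fderiv_g_ψ hx u v w
    simp only [H.fderiv_g_eq_christoffel hx] at h
    have e1 : ∀ a b c, g x (christoffel g x a b) (ψ x c) = -g x c (ψ x (christoffel g x b a)) := by
      intro a b c
      rw [H.christoffel_symm hx a b, A.symm, A.g_ψ_left]
    rw [e1, e1 v w u, e1 w u v] at h
    simp only [hP, map_add, map_sub]
    rw [H.christoffel_symm hx v u, H.christoffel_symm hx u w, H.christoffel_symm hx w v] at *
    linarith
  have normal : ∀ u v, P (ψ x u) v - P (ψ x v) u + ψ x (P v u) - ψ x (P u v)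
      = (2 * g x u (ψ x v)) • ξ x := fun u v ↦ by
    rw [← H.normal x hx u v]
    simp only [hP, map_add, map_sub]
    rw [H.christoffel_symm hx (ψ x u) (ψ x v), H.christoffel_symm hx (ψ x u) v,
      H.christoffel_symm hx (ψ x v) u, H.christoffel_symm hx u v]
    abel
  have P_ξ : ∀ u, P u (ξ x) = -ψ x (K u) := fun u ↦ by
    have h := H.fderiv_ψ_ξ hx u
    simp only [hP, K_apply, A.ψ_ξ, map_add, map_zero]
    rw [eq_neg_of_add_eq_zero_left h]
    abel
  have contact : ∀ u v, g x (K u) v - g x (K v) u = 2 * g x u (ψ x v) := fun u v ↦ by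
    have h := H.contact x hx u v
    rw [hη, hη, H.christoffel_symm hx u v] at h
    linarith
  have K_ξ : ∀ u, g x (K u) (ξ x) = 0 := fun u ↦ by
    have h := H.fderiv_g_ξ_ξ hx u
    rw [H.fderiv_g_eq_christoffel hx, A.symm (ξ x)] at h
    rw [K_apply, map_add, add_apply]
    linarith
  have hKψ : ∀ u, K u = -ψ x u :=
    A.covDeriv_ξ_eq (by simp [hP]) skew cyclic normal P_ξ contact K_ξ
  refine ⟨hKψ, A.covDeriv_ψ_eq skew cyclic normal (fun u ↦ (P_ξ u).trans (by rw [hKψ]; simp))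
    fun u v ↦ ?_⟩
  have h := H.fderiv_ψ_sq hx u v
  have hξ' : fderiv ℝ ξ x u = -ψ x u - christoffel g x u (ξ x) := by
    rw [← hKψ, K_apply]; abel
  rw [hη, hKψ, hξ', map_neg, neg_apply] at h
  have h2 := A.ψ_sq v
  have h3 : P u (ψ x v) + ψ x (P u v)
      = (fderiv ℝ ψ x u (ψ x v) + ψ x (fderiv ℝ ψ x u v)) + christoffel g x u (ψ x (ψ x v))
        - ψ x (ψ x (christoffel g x u v)) := by
    simp only [hP, map_add, map_sub]
    abel
  rw [h3, h, A.ψ_sq, A.ψ_sq, map_sub, map_smul]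
  module

/-- The metric is parallel for the canonical connection. -/
theorem fderiv_g_eq (u v w : E) : fderiv ℝ g x u v w
    = g x (canonicalChristoffel ψ ξ η g x u v) w + g x v (canonicalChristoffel ψ ξ η g x u w) := by
  have A := H.algebra x hx
  rw [H.fderiv_g_eq_christoffel hx]
  simp only [canonicalChristoffel_apply, map_add, map_smul, add_apply, smul_apply, smul_eq_mul,
    A.g_ψ_left, A.g_ξ, A.symm v (ξ x)]
  have h := A.g_ψ_left u v
  rw [A.symm] at h
  linear_combination -η x w * h

/-- The contact form is parallel for the canonical connection. -/
theorem fderiv_η_eq_canonical (u v : E) :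
    fderiv ℝ η x u v = η x (canonicalChristoffel ψ ξ η g x u v) := by
  have A := H.algebra x hx
  have hK := (H.leviCivita_derivatives hx).1 u
  have h : fderiv ℝ ξ x u = -ψ x u - christoffel g x u (ξ x) := by rw [← hK]; abel
  rw [H.fderiv_η_eq hx, H.fderiv_g_eq_christoffel hx, h]
  simp only [canonicalChristoffel_apply, map_add, map_sub, map_neg, map_smul, sub_apply, neg_apply,
    A.η_ψ, A.g_ψ_left, A.g_ξ, A.η_ξ, smul_eq_mul]
  ring

/-- The endomorphism `ψ` is parallel for the canonical connection. -/
theorem fderiv_ψ_eq (u v : E) : fderiv ℝ ψ x u v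
    = ψ x (canonicalChristoffel ψ ξ η g x u v) - canonicalChristoffel ψ ξ η g x u (ψ x v) := by
  have A := H.algebra x hx
  have h := (H.leviCivita_derivatives hx).2 u v
  have h' : fderiv ℝ ψ x u v = η x v • u - g x u v • ξ x - christoffel g x u (ψ x v)
      + ψ x (christoffel g x u v) := by rw [← h]; abel
  rw [h']
  simp only [canonicalChristoffel_apply, map_add, map_sub, map_smul, A.η_ψ, A.ψ_sq, A.ψ_ξ,
    A.symm u (ξ x), A.g_ξ, smul_eq_mul]
  module

/-- The torsion of the canonical connection is `2 dη ⊗ ξ`. -/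
theorem canonicalChristoffel_torsion (u v : E) :
    canonicalChristoffel ψ ξ η g x u v - canonicalChristoffel ψ ξ η g x v u
      = (2 * g x u (ψ x v)) • ξ x := by
  have A := H.algebra x hx
  have h : g x v (ψ x u) = -g x u (ψ x v) := by rw [A.symm, A.g_ψ_left]
  simp only [canonicalChristoffel_apply, H.christoffel_symm hx u v, h]
  module

omit hx in
theorem contDiffOn_canonicalChristoffel : ContDiffOn ℝ ∞ (canonicalChristoffel ψ ξ η g) U := by
  refine contDiffOn_clm_apply.2 fun u ↦ contDiffOn_clm_apply.2 fun v ↦ ?_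
  simp only [canonicalChristoffel_apply]
  have hΓ := contDiffOn_christoffel H.isOpen H.smooth_g
    fun x hx ↦ (H.algebra x hx).nondegenerate
  have hψ : ∀ w, ContDiffOn ℝ ∞ (fun x ↦ ψ x w) U := fun w ↦ H.smooth_ψ.clm_apply contDiffOn_const
  have hη : ∀ w, ContDiffOn ℝ ∞ (fun x ↦ η x w) U := fun w ↦ H.smooth_η.clm_apply contDiffOn_const
  exact ((((hΓ.clm_apply contDiffOn_const).clm_apply contDiffOn_const).add
    ((hη u).smul (hψ v))).add ((hη v).smul (hψ u))).add
    (((H.smooth_g.clm_apply contDiffOn_const).clm_apply (hψ v)).smul H.smooth_ξ)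

end IsParaSasakianOn

end Christoffel

/-! ### Adapted frames -/

section AdaptedFrame

variable {V : Type*} [NormedAddCommGroup V] [NormedSpace ℝ V] [FiniteDimensional ℝ V]
  {ψ : V →L[ℝ] V} {ξ : V} {η : V →L[ℝ] ℝ} {g : V →L[ℝ] V →L[ℝ] ℝ}

/-- Vectors `eᵢ` and `fᵢ` in the `-1` and `+1` eigenspaces of `ψ` which together with `ξ` form a
frame with `g(eᵢ, fⱼ) = ½ δᵢⱼ`. This is encoded by the dual statement `metric`: with
`αᵢ = 2g(fᵢ, ·)` and `βᵢ = 2g(eᵢ, ·)`, the metric is `η ⊗ η + ½ ∑ (αᵢ ⊗ βᵢ + βᵢ ⊗ αᵢ)`. -/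
structure IsAdaptedFrame {V : Type*} [AddCommGroup V] [Module ℝ V] [TopologicalSpace V]
    [IsTopologicalAddGroup V] [ContinuousSMul ℝ V] {n : ℕ} (ψ : V →L[ℝ] V) (η : V →L[ℝ] ℝ)
    (g : V →L[ℝ] V →L[ℝ] ℝ) (e f : Fin n → V) : Prop where
  ψ_e : ∀ i, ψ (e i) = -e i
  ψ_f : ∀ i, ψ (f i) = f i
  η_e : ∀ i, η (e i) = 0
  η_f : ∀ i, η (f i) = 0
  metric : ∀ v w, g v w = η v * η w
    + 2 * ∑ i, (g (f i) v * g (e i) w + g (e i) v * g (f i) w)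

/-- A paracontact metric structure whose `±1` eigenspaces have dimension `n` has an adapted frame:
`g` pairs the two eigenspaces perfectly, so that a basis of one has a dual basis in the other. -/
theorem IsParacontactAlgebra.exists_isAdaptedFrame (H : IsParacontactAlgebra ψ ξ η g) {n : ℕ}
    (hpos : Module.finrank ℝ ↥(LinearMap.ker (η : V →ₗ[ℝ] ℝ) ⊓
      Module.End.eigenspace (ψ : V →ₗ[ℝ] V) 1) = n)
    (hneg : Module.finrank ℝ ↥(LinearMap.ker (η : V →ₗ[ℝ] ℝ) ⊓
      Module.End.eigenspace (ψ : V →ₗ[ℝ] V) (-1)) = n) :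
    ∃ e f : Fin n → V, IsAdaptedFrame ψ η g e f := by
  set P : Submodule ℝ V := LinearMap.ker (η : V →ₗ[ℝ] ℝ) ⊓
    Module.End.eigenspace (ψ : V →ₗ[ℝ] V) 1 with hP
  set N : Submodule ℝ V := LinearMap.ker (η : V →ₗ[ℝ] ℝ) ⊓
    Module.End.eigenspace (ψ : V →ₗ[ℝ] V) (-1) with hN
  have memP : ∀ v, v ∈ P ↔ η v = 0 ∧ ψ v = v := fun v ↦ by
    simp [hP]
  have memN : ∀ v, v ∈ N ↔ η v = 0 ∧ ψ v = -v := fun v ↦ by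
    simp [hN]
  have isoP : ∀ v ∈ P, ∀ w ∈ P, g v w = 0 := fun v hv w hw ↦ by
    have := H.compatible v w
    rw [((memP v).1 hv).2, ((memP w).1 hw).2, ((memP v).1 hv).1] at this
    linarith
  have isoN : ∀ v ∈ N, ∀ w ∈ N, g v w = 0 := fun v hv w hw ↦ by
    have := H.compatible v w
    rw [((memN v).1 hv).2, ((memN w).1 hw).2, ((memN v).1 hv).1, map_neg, map_neg,
      neg_apply] at this
    linarith
  set pos : V → V := fun v ↦ (1 / 2 : ℝ) • (ψ (ψ v) + ψ v) with hpos'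
  set neg : V → V := fun v ↦ (1 / 2 : ℝ) • (ψ (ψ v) - ψ v) with hneg'
  have hψ3 : ∀ v, ψ (ψ (ψ v)) = ψ v := fun v ↦ by rw [H.ψ_sq (ψ v), H.η_ψ]; simp
  have posP : ∀ v, pos v ∈ P := fun v ↦ (memP _).2 ⟨by simp [hpos', H.η_ψ], by
    simp only [hpos', map_smul, map_add, hψ3]; module⟩
  have negN : ∀ v, neg v ∈ N := fun v ↦ (memN _).2 ⟨by simp [hneg', H.η_ψ], by
    simp only [hneg', map_smul, map_sub, hψ3]; module⟩
  have decomp : ∀ v, v = η v • ξ + pos v + neg v := fun v ↦ by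
    simp only [hpos', hneg', H.ψ_sq]; module
  clear_value pos neg
  have orthP : ∀ v ∈ P, ∀ w, g v w = g v (neg w) := fun v hv w ↦ by
    conv_lhs => rw [decomp w]
    rw [map_add, map_add, map_smul, H.symm v ξ, H.g_ξ, ((memP v).1 hv).1, isoP v hv _ (posP w)]
    simp
  have orthN : ∀ v ∈ N, ∀ w, g v w = g v (pos w) := fun v hv w ↦ by
    conv_lhs => rw [decomp w]
    rw [map_add, map_add, map_smul, H.symm v ξ, H.g_ξ, ((memN v).1 hv).1, isoN v hv _ (negN w)]
    simp
  -- The pairing `N → P*` induced by `2g`.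
  let B : N →ₗ[ℝ] Module.Dual ℝ P :=
    { toFun := fun v ↦ (2 : ℝ) • (g v : V →ₗ[ℝ] ℝ).domRestrict P
      map_add' := fun v w ↦ by ext; simp [mul_add]
      map_smul' := fun c v ↦ by ext; simp [mul_left_comm] }
  have B_apply : ∀ (v : N) (w : P), B v w = 2 * g v w := fun v w ↦ rfl
  have Binj : Function.Injective B := (injective_iff_map_eq_zero _).2 fun v hv ↦ by
    refine Subtype.ext (H.nondegenerate _ fun w ↦ ?_)
    have := B_apply v ⟨pos w, posP w⟩
    rw [hv] at this
    rw [orthN v v.2]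
    simpa using this.symm
  let Be : N ≃ₗ[ℝ] Module.Dual ℝ P := LinearEquiv.ofInjectiveOfFinrankEq B Binj
    (by rw [Subspace.dual_finrank_eq, hneg, hpos])
  let b : Module.Basis (Fin n) ℝ P := Module.finBasisOfFinrankEq ℝ P hpos
  refine ⟨fun i ↦ Be.symm (b.coord i), fun i ↦ b i, ?_⟩
  have he : ∀ i, ((Be.symm (b.coord i) : N) : V) ∈ N := fun i ↦ (Be.symm (b.coord i)).2
  have hf : ∀ i, (b i : V) ∈ P := fun i ↦ (b i).2
  have hef : ∀ i (w : P), 2 * g (Be.symm (b.coord i) : N) w = b.coord i w := fun i w ↦ by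
    rw [← B_apply]
    exact congr($(Be.apply_symm_apply (b.coord i)) w)
  refine ⟨fun i ↦ ((memN _).1 (he i)).2, fun i ↦ ((memP _).1 (hf i)).2,
    fun i ↦ ((memN _).1 (he i)).1, fun i ↦ ((memP _).1 (hf i)).1, fun v w ↦ ?_⟩
  have key : ∀ v w, g (pos v) (neg w) = 2 * ∑ i, g (Be.symm (b.coord i) : N) v * g (b i) w := by
    intro v w
    have hsum : pos v = ∑ i, (2 * g (Be.symm (b.coord i) : N) v) • (b i : V) := by
      have := congrArg (Subtype.val) (b.sum_repr ⟨pos v, posP v⟩)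
      refine this.symm.trans ?_
      simp only [Submodule.coe_sum, Submodule.coe_smul]
      refine Finset.sum_congr rfl fun i _ ↦ ?_
      rw [orthN _ (he i) v, hef i ⟨pos v, posP v⟩]
      rfl
    rw [hsum, map_sum, Finset.mul_sum, sum_apply]
    refine Finset.sum_congr rfl fun i _ ↦ ?_
    rw [map_smul, smul_apply, ← orthP _ (hf i), smul_eq_mul]
    ring
  have hv := decomp v
  have hw := decomp w
  have e1 : g v w = η v * η w + g (pos v) (neg w) + g (pos w) (neg v) := by
    conv_lhs => rw [hv, map_add, map_add, map_smul, add_apply, add_apply, smul_apply, H.g_ξ,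
      orthP _ (posP v), orthN _ (negN v), H.symm (neg v)]
    rfl
  rw [e1, key, key, Finset.sum_add_distrib, mul_add, add_assoc, add_comm (2 * _) (2 * _)]
  simp only [mul_comm (g (b _) _)]

end AdaptedFrame

/-! ### Parallel frames of a flat connection -/

section ParallelFrame

set_option maxSynthPendingDepth 3

open Metric

variable {E : Type*} [NormedAddCommGroup E] [NormedSpace ℝ E]

/-- The curvature of the connection with Christoffel symbols `Γ` vanishes on `U`. Here `Γ x u v` is
the derivative of the constant field `v` in the direction `u`. -/
def IsFlatOn (U : Set E) (Γ : E → E →L[ℝ] E →L[ℝ] E) : Prop :=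
  ∀ x ∈ U, ∀ u w v, fderiv ℝ Γ x u w v - fderiv ℝ Γ x w u v
    + Γ x u (Γ x w v) - Γ x w (Γ x u v) = 0

theorem eq_of_hasFDerivAt_zero {F : Type*} [NormedAddCommGroup F] [NormedSpace ℝ F] {f : E → F}
    {x₀ x : E} {r : ℝ} (hf : ∀ y ∈ ball x₀ r, HasFDerivAt f (0 : E →L[ℝ] F) y)
    (hx : x ∈ ball x₀ r) : f x = f x₀ := by
  have hr : 0 < r := dist_nonneg.trans_lt (mem_ball.1 hx)
  have := (convex_ball x₀ r).norm_image_sub_le_of_norm_hasFDerivWithin_le (C := 0)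
    (fun y hy ↦ (hf y hy).hasFDerivWithinAt) (by simp) (mem_ball_self hr) hx
  rwa [zero_mul, norm_le_zero_iff, sub_eq_zero] at this

variable [FiniteDimensional ℝ E]

/-- A flat connection has a parallel transport `A x : T_{x₀} → T_x` near any point. -/
theorem IsFlatOn.exists_parallel {U : Set E} (hU : IsOpen U) {Γ : E → E →L[ℝ] E →L[ℝ] E}
    (hΓ : ContDiffOn ℝ ∞ Γ U) (hflat : IsFlatOn U Γ) {x₀ : E} (hx₀ : x₀ ∈ U) :
    ∃ r > 0, ball x₀ r ⊆ U ∧ ∃ A : E → E →L[ℝ] E, A x₀ = ContinuousLinearMap.id ℝ E ∧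
      ContDiffOn ℝ ∞ A (ball x₀ r) ∧
      ∀ x ∈ ball x₀ r, ∀ u v, fderiv ℝ A x u v = -Γ x u (A x v) := by
  -- The total differential system `A'(u) = -Γ(u) ∘ A`, with `T` turning `Γ` into its coefficients.
  let T : (E →L[ℝ] E →L[ℝ] E) →L[ℝ] ((E →L[ℝ] E) →L[ℝ] E →L[ℝ] (E →L[ℝ] E)) :=
    -((ContinuousLinearMap.flipₗᵢ ℝ E (E →L[ℝ] E) (E →L[ℝ] E) :
        (E →L[ℝ] (E →L[ℝ] E) →L[ℝ] (E →L[ℝ] E)) →L[ℝ] _) ∘L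
      (ContinuousLinearMap.compL ℝ E (E →L[ℝ] E) ((E →L[ℝ] E) →L[ℝ] (E →L[ℝ] E))
        (ContinuousLinearMap.compL ℝ E E E)))
  have T_apply : ∀ (C : E →L[ℝ] E →L[ℝ] E) (A : E →L[ℝ] E) (u : E), T C A u = -(C u ∘L A) :=
    fun _ _ _ ↦ rfl
  set G : E → (E →L[ℝ] E) →L[ℝ] E →L[ℝ] (E →L[ℝ] E) := fun x ↦ T (Γ x) with hG
  have hGs : ContDiffOn ℝ ∞ G U := T.contDiff.comp_contDiffOn hΓ
  have hG' : ∀ x ∈ U, fderiv ℝ G x = T ∘L fderiv ℝ Γ x := fun x hx ↦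
    (T.hasFDerivAt.comp x (hasFDerivAt_of_contDiffOn hU hΓ hx)).fderiv
  obtain ⟨r, hr, hsub, A, hA0, hA⟩ := exists_forall_hasFDerivAt_of_flat hU hx₀
    (hGs.of_le ENat.LEInfty.out) (fun x hx B u w ↦ by
      ext v
      have h := hflat x hx u w (B v)
      rw [hG' x hx]
      simp only [hG, ContinuousLinearMap.comp_apply, T_apply, add_apply, neg_apply,
        map_neg, neg_neg]
      rw [← sub_eq_zero, ← neg_eq_zero, ← h]
      abel) (ContinuousLinearMap.id ℝ E)
  -- The solution gains regularity from the equation it satisfies.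
  have hs : ∀ n : ℕ, ContDiffOn ℝ n A (ball x₀ r) := by
    intro n
    induction n with
    | zero =>
      exact contDiffOn_zero.2 fun x hx ↦ (hA x hx).continuousAt.continuousWithinAt
    | succ n ih =>
      refine (contDiffOn_succ_iff_fderiv_of_isOpen isOpen_ball).2
        ⟨fun x hx ↦ (hA x hx).differentiableAt.differentiableWithinAt,
          fun h ↦ absurd h (WithTop.natCast_ne_top n), ?_⟩
      refine ContDiffOn.congr (f := fun x ↦ G x (A x)) ?_ fun x hx ↦ (hA x hx).fderiv
      exact ((hGs.of_le (mod_cast le_top)).mono hsub).clm_apply ih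
  refine ⟨r, hr, hsub, A, hA0, contDiffOn_infty.2 hs, fun x hx u v ↦ ?_⟩
  rw [(hA x hx).fderiv]
  simp [hG, T_apply]

/-- If the canonical connection of a para-Sasakian structure is flat, then adapted frames extend
to parallel adapted frames. -/
theorem IsParaSasakianOn.exists_parallel_frame {U : Set E} {ψ : E → E →L[ℝ] E} {ξ : E → E}
    {η : E → E →L[ℝ] ℝ} {g : E → E →L[ℝ] E →L[ℝ] ℝ} (H : IsParaSasakianOn U ψ ξ η g)
    (hflat : IsFlatOn U (canonicalChristoffel ψ ξ η g)) {x₀ : E} (hx₀ : x₀ ∈ U) {n : ℕ}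
    {e₀ f₀ : Fin n → E} (h₀ : IsAdaptedFrame (ψ x₀) (η x₀) (g x₀) e₀ f₀) :
    ∃ r > 0, ball x₀ r ⊆ U ∧ ∃ e f : Fin n → E → E,
      (∀ i, ContDiffOn ℝ ∞ (e i) (ball x₀ r)) ∧ (∀ i, ContDiffOn ℝ ∞ (f i) (ball x₀ r)) ∧
      ∀ x ∈ ball x₀ r, IsAdaptedFrame (ψ x) (η x) (g x) (e · x) (f · x) ∧
        (∀ i u, fderiv ℝ (e i) x u = -canonicalChristoffel ψ ξ η g x u (e i x)) ∧
        (∀ i u, fderiv ℝ (f i) x u = -canonicalChristoffel ψ ξ η g x u (f i x)) := by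
  obtain ⟨r, hr, hsub, A, hA0, hAs, hA⟩ :=
    hflat.exists_parallel H.isOpen H.contDiffOn_canonicalChristoffel hx₀
  set Γ := canonicalChristoffel ψ ξ η g
  have hAd : ∀ x ∈ ball x₀ r, ∀ v, HasFDerivAt (fun y ↦ A y v) _ x := fun x hx v ↦
    (hasFDerivAt_of_contDiffOn isOpen_ball hAs hx).clm_apply (hasFDerivAt_const v x)
  -- Tensors which are parallel have constant components in the parallel frames.
  have cη : ∀ x ∈ ball x₀ r, ∀ v, η x (A x v) = η x₀ v := by
    intro x hx v
    have := eq_of_hasFDerivAt_zero (f := fun y ↦ η y (A y v)) (fun y hy ↦ ?_) hx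
    · simpa [hA0] using this
    · refine ((H.hasFDerivAt_η (hsub hy)).clm_apply (hAd y hy v)).congr_fderiv ?_
      ext u
      simp [hA y hy, H.fderiv_η_eq_canonical (hsub hy), Γ]
  have cg : ∀ x ∈ ball x₀ r, ∀ v w, g x (A x v) (A x w) = g x₀ v w := by
    intro x hx v w
    have := eq_of_hasFDerivAt_zero (f := fun y ↦ g y (A y v) (A y w)) (fun y hy ↦ ?_) hx
    · simpa [hA0] using this
    · refine (((H.hasFDerivAt_g (hsub hy)).clm_apply (hAd y hy v)).clm_apply
        (hAd y hy w)).congr_fderiv ?_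
      ext u
      simp [hA y hy, H.fderiv_g_eq (hsub hy), Γ]
  have cψ : ∀ x ∈ ball x₀ r, ∀ v w, g x (ψ x (A x v)) (A x w) = g x₀ (ψ x₀ v) w := by
    intro x hx v w
    have := eq_of_hasFDerivAt_zero (f := fun y ↦ g y (ψ y (A y v)) (A y w)) (fun y hy ↦ ?_) hx
    · simpa [hA0] using this
    · refine (((H.hasFDerivAt_g (hsub hy)).clm_apply ((H.hasFDerivAt_ψ (hsub hy)).clm_apply
        (hAd y hy v))).clm_apply (hAd y hy w)).congr_fderiv ?_
      ext u
      simp [hA y hy, H.fderiv_g_eq (hsub hy), H.fderiv_ψ_eq (hsub hy), Γ]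
      ring
  have hsurj : ∀ x ∈ ball x₀ r, Function.Surjective (A x) := fun x hx ↦ by
    have hinj : Function.Injective (A x : E →ₗ[ℝ] E) := (injective_iff_map_eq_zero _).2 fun v hv ↦
      (H.algebra x₀ hx₀).nondegenerate v fun w ↦ by
        rw [← cg x hx, show A x v = 0 from hv]; simp
    exact LinearMap.injective_iff_surjective.1 hinj
  have cψ' : ∀ x ∈ ball x₀ r, ∀ v, ψ x (A x v) = A x (ψ x₀ v) := fun x hx v ↦
    (H.algebra x (hsub hx)).ext_left fun w ↦ by
      obtain ⟨w, rfl⟩ := hsurj x hx w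
      rw [cψ x hx, cg x hx]
  refine ⟨r, hr, hsub, fun i x ↦ A x (e₀ i), fun i x ↦ A x (f₀ i),
    fun i ↦ hAs.clm_apply contDiffOn_const, fun i ↦ hAs.clm_apply contDiffOn_const,
    fun x hx ↦ ⟨⟨fun i ↦ ?_, fun i ↦ ?_, fun i ↦ ?_, fun i ↦ ?_, fun v w ↦ ?_⟩,
      fun i u ↦ ?_, fun i u ↦ ?_⟩⟩
  · rw [cψ' x hx, h₀.ψ_e, map_neg]
  · rw [cψ' x hx, h₀.ψ_f]
  · rw [cη x hx, h₀.η_e]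
  · rw [cη x hx, h₀.η_f]
  · obtain ⟨v, rfl⟩ := hsurj x hx v
    obtain ⟨w, rfl⟩ := hsurj x hx w
    simp only [cg x hx, cη x hx]
    exact h₀.metric v w
  · rw [(hAd x hx (e₀ i)).fderiv]
    simp [hA x hx]
  · rw [(hAd x hx (f₀ i)).fderiv]
    simp [hA x hx]

end ParallelFrame

/-! ### Normal form on an open subset of a vector space -/

section NormalForm

set_option maxSynthPendingDepth 3

open Metric

variable {E : Type*} [NormedAddCommGroup E] [NormedSpace ℝ E]

/-- A smooth closed `1`-form on a ball has a smooth primitive. -/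
theorem exists_primitive_on_ball {F : Type*} [NormedAddCommGroup F] [NormedSpace ℝ F]
    [CompleteSpace F] {x₀ : E} {r : ℝ} {θ : E → E →L[ℝ] F}
    (hθ : ContDiffOn ℝ ∞ θ (ball x₀ r))
    (hclosed : ∀ x ∈ ball x₀ r, ∀ u v, fderiv ℝ θ x u v = fderiv ℝ θ x v u) :
    ∃ f : E → F, ContDiffOn ℝ ∞ f (ball x₀ r) ∧ ∀ x ∈ ball x₀ r, HasFDerivAt f (θ x) x := by
  obtain ⟨f, hf⟩ := (convex_ball x₀ r).exists_forall_hasFDerivAt_of_fderiv_symmetric isOpen_ball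
    (hθ.differentiableOn (by simp)) hclosed
  refine ⟨f, (contDiffOn_infty_iff_fderiv_of_isOpen isOpen_ball).2
    ⟨fun x hx ↦ (hf x hx).differentiableAt.differentiableWithinAt,
      hθ.congr fun x hx ↦ (hf x hx).fderiv⟩, hf⟩

theorem stdForm_apply {n : ℕ} (p v : CoordSpace n) :
    stdForm n p v = v.2.2 - ∑ i, p.2.1 i * v.1 i := rfl

theorem stdEnd_apply {n : ℕ} (p v : CoordSpace n) :
    stdEnd n p v = (-v.1, v.2.1, -∑ i, p.2.1 i * v.1 i) := rfl

theorem stdMetric_apply {n : ℕ} (p v w : CoordSpace n) :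
    stdMetric n p v w = stdForm n p v * stdForm n p w
      + (1 / 2) * ∑ i, (v.1 i * w.2.1 i + v.2.1 i * w.1 i) := rfl

/-- The isomorphism onto the standard structure, read off from an adapted frame: the components of
`D` are `dxᵢ = 2g(fᵢ, ·)`, `dyᵢ = 2g(eᵢ, ·)` and `dz = η + ∑ yᵢ dxᵢ`. -/
theorem IsAdaptedFrame.std_eq {V : Type*} [AddCommGroup V] [Module ℝ V] [TopologicalSpace V]
    [IsTopologicalAddGroup V] [ContinuousSMul ℝ V] {n : ℕ} {ψ : V →L[ℝ] V} {ξ : V}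
    {η : V →L[ℝ] ℝ} {g : V →L[ℝ] V →L[ℝ] ℝ} {e f : Fin n → V}
    (F : IsAdaptedFrame ψ η g e f) (H : IsParacontactAlgebra ψ ξ η g) {p : CoordSpace n}
    {D : V →L[ℝ] CoordSpace n}
    (hD : ∀ v, D v = (fun i ↦ 2 * g (f i) v, fun i ↦ 2 * g (e i) v,
      η v + ∑ i, p.2.1 i * (2 * g (f i) v))) :
    (∀ v, D (ψ v) = stdEnd n p (D v)) ∧ D ξ = ((0, 0, 1) : CoordSpace n) ∧
      (∀ v, stdForm n p (D v) = η v) ∧ ∀ v w, stdMetric n p (D v) (D w) = g v w := by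
  have hf : ∀ i v, g (f i) (ψ v) = -g (f i) v := fun i v ↦ by
    have := H.g_ψ_left (f i) v
    rw [F.ψ_f] at this
    linarith
  have he : ∀ i v, g (e i) (ψ v) = g (e i) v := fun i v ↦ by
    have := H.g_ψ_left (e i) v
    rw [F.ψ_e, map_neg, neg_apply] at this
    linarith
  have hform : ∀ v, stdForm n p (D v) = η v := fun v ↦ by
    simp only [stdForm_apply, hD]
    ring
  refine ⟨fun v ↦ ?_, ?_, hform, fun v w ↦ ?_⟩
  · simp only [hD, stdEnd_apply, H.η_ψ, hf, he, zero_add]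
    refine Prod.ext (funext fun i ↦ ?_) (Prod.ext rfl ?_)
    · simp
    · simp
  · simp only [hD, H.η_ξ, H.symm _ ξ, H.g_ξ, F.η_e, F.η_f]
    simp
    rfl
  · rw [stdMetric_apply, hform, hform, F.metric v w]
    simp only [hD, Finset.mul_sum]
    congr 1
    refine Finset.sum_congr rfl fun i _ ↦ ?_
    ring

variable [FiniteDimensional ℝ E]

/-- A para-Sasakian structure with flat canonical connection on an open subset of a vector space is
locally isomorphic to the standard one. -/
theorem IsParaSasakianOn.exists_normal_form {U : Set E} {ψ : E → E →L[ℝ] E} {ξ : E → E}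
    {η : E → E →L[ℝ] ℝ} {g : E → E →L[ℝ] E →L[ℝ] ℝ} (H : IsParaSasakianOn U ψ ξ η g)
    (hflat : IsFlatOn U (canonicalChristoffel ψ ξ η g)) {x₀ : E} (hx₀ : x₀ ∈ U) {n : ℕ}
    (hdim : Module.finrank ℝ E = 2 * n + 1)
    (hpos : Module.finrank ℝ ↥(LinearMap.ker (η x₀ : E →ₗ[ℝ] ℝ) ⊓
      Module.End.eigenspace (ψ x₀ : E →ₗ[ℝ] E) 1) = n)
    (hneg : Module.finrank ℝ ↥(LinearMap.ker (η x₀ : E →ₗ[ℝ] ℝ) ⊓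
      Module.End.eigenspace (ψ x₀ : E →ₗ[ℝ] E) (-1)) = n) :
    ∃ Ψ : OpenPartialHomeomorph E (CoordSpace n), x₀ ∈ Ψ.source ∧ Ψ.source ⊆ U ∧
      ContDiffOn ℝ ∞ Ψ Ψ.source ∧ ContDiffOn ℝ ∞ Ψ.symm Ψ.target ∧
      ∀ q ∈ Ψ.source,
        (∀ v, fderiv ℝ Ψ q (ψ q v) = stdEnd n (Ψ q) (fderiv ℝ Ψ q v)) ∧
        fderiv ℝ Ψ q (ξ q) = ((0, 0, 1) : CoordSpace n) ∧
        (∀ v, stdForm n (Ψ q) (fderiv ℝ Ψ q v) = η q v) ∧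
        ∀ v w, stdMetric n (Ψ q) (fderiv ℝ Ψ q v) (fderiv ℝ Ψ q w) = g q v w := by
  obtain ⟨e₀, f₀, h₀⟩ := (H.algebra x₀ hx₀).exists_isAdaptedFrame hpos hneg
  obtain ⟨r, hr, hsub, e, f, hes, hfs, hfr⟩ := H.exists_parallel_frame hflat hx₀ h₀
  set B := ball x₀ r with hB
  have hBo : IsOpen B := isOpen_ball
  -- The covectors metrically dual to parallel horizontal fields are closed.
  have hdual : ∀ s : E → E, ContDiffOn ℝ ∞ s B → (∀ x ∈ B, η x (s x) = 0) →
      (∀ x ∈ B, ∀ u, fderiv ℝ s x u = -canonicalChristoffel ψ ξ η g x u (s x)) →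
      ContDiffOn ℝ ∞ (fun x ↦ (2 : ℝ) • g x (s x)) B ∧
      ∀ x ∈ B, ∀ u v, fderiv ℝ (fun x ↦ (2 : ℝ) • g x (s x)) x u v
        = fderiv ℝ (fun x ↦ (2 : ℝ) • g x (s x)) x v u := by
    intro s hs hηs hds
    refine ⟨((H.smooth_g.mono hsub).clm_apply hs).const_smul 2, fun x hx u v ↦ ?_⟩
    have hd : HasFDerivAt (fun x ↦ (2 : ℝ) • g x (s x)) _ x :=
      ((H.hasFDerivAt_g (hsub hx)).clm_apply
        (hasFDerivAt_of_contDiffOn hBo hs hx)).const_smul (2 : ℝ)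
    have key : ∀ u v, fderiv ℝ (fun x ↦ (2 : ℝ) • g x (s x)) x u v
        = 2 * g x (s x) (canonicalChristoffel ψ ξ η g x u v) := fun u v ↦ by
      rw [hd.fderiv]
      simp [hds x hx, H.fderiv_g_eq (hsub hx)]
      ring
    -- The torsion is a multiple of `ξ`, to which `s` is orthogonal.
    have htor := congrArg (g x (s x)) (H.canonicalChristoffel_torsion (hsub hx) u v)
    rw [map_smul, (H.algebra x (hsub hx)).symm _ (ξ x), (H.algebra x (hsub hx)).g_ξ, hηs x hx,
      smul_zero, map_sub] at htor
    rw [key, key]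
    linarith
  have hX : ∀ i, ∃ X : E → ℝ, ContDiffOn ℝ ∞ X B ∧
      ∀ x ∈ B, HasFDerivAt X ((2 : ℝ) • g x (f i x)) x := fun i ↦ by
    have := hdual (f i) (hfs i) (fun x hx ↦ (hfr x hx).1.η_f i) (fun x hx ↦ (hfr x hx).2.2 i)
    exact exists_primitive_on_ball this.1 this.2
  have hY : ∀ i, ∃ Y : E → ℝ, ContDiffOn ℝ ∞ Y B ∧
      ∀ x ∈ B, HasFDerivAt Y ((2 : ℝ) • g x (e i x)) x := fun i ↦ by
    have := hdual (e i) (hes i) (fun x hx ↦ (hfr x hx).1.η_e i) (fun x hx ↦ (hfr x hx).2.1 i)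
    exact exists_primitive_on_ball this.1 this.2
  choose X hXs hXd using hX
  choose Y hYs hYd using hY
  set α : E → E →L[ℝ] ℝ := fun x ↦ η x + ∑ i, Y i x • ((2 : ℝ) • g x (f i x)) with hα
  have hfd : ∀ i, ContDiffOn ℝ ∞ (fun x ↦ (2 : ℝ) • g x (f i x)) B := fun i ↦
    (hdual (f i) (hfs i) (fun x hx ↦ (hfr x hx).1.η_f i) (fun x hx ↦ (hfr x hx).2.2 i)).1
  have hαs : ContDiffOn ℝ ∞ α B :=
    (H.smooth_η.mono hsub).add (ContDiffOn.sum fun i _ ↦ (hYs i).smul (hfd i))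
  -- By the contact condition and `F.metric`, `dη` cancels against `∑ dyᵢ ∧ dxᵢ`.
  have hαclosed : ∀ x ∈ B, ∀ u v, fderiv ℝ α x u v = fderiv ℝ α x v u := by
    intro x hx u v
    have A := H.algebra x (hsub hx)
    have F := (hfr x hx).1
    have hd : HasFDerivAt α _ x := (H.hasFDerivAt_η (hsub hx)).add (HasFDerivAt.fun_sum fun i _ ↦
      (hYd i x hx).smul (hasFDerivAt_of_contDiffOn hBo (hfd i) hx))
    have key : ∀ u v, fderiv ℝ α x u v = fderiv ℝ η x u v
        + ∑ i, (Y i x * fderiv ℝ (fun x ↦ (2 : ℝ) • g x (f i x)) x u v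
          + 4 * (g x (e i x) u * g x (f i x) v)) := fun u v ↦ by
      rw [hd.fderiv]
      simp only [add_apply, sum_apply, ContinuousLinearMap.smulRight_apply, smul_apply,
        smul_eq_mul]
      congr 1
      refine Finset.sum_congr rfl fun i _ ↦ ?_
      ring
    have hcl := fun i ↦ (hdual (f i) (hfs i) (fun x hx ↦ (hfr x hx).1.η_f i)
      (fun x hx ↦ (hfr x hx).2.2 i)).2 x hx u v
    have hm := F.metric u (ψ x v)
    have hf : ∀ i v, g x (f i x) (ψ x v) = -g x (f i x) v := fun i v ↦ by
      have := A.g_ψ_left (f i x) v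
      rw [F.ψ_f] at this
      linarith
    have he : ∀ i v, g x (e i x) (ψ x v) = g x (e i x) v := fun i v ↦ by
      have := A.g_ψ_left (e i x) v
      rw [F.ψ_e, map_neg, neg_apply] at this
      linarith
    have hc := H.contact x (hsub hx) u v
    simp only [A.η_ψ, mul_zero, zero_add, hf, he] at hm
    rw [hm, ← mul_assoc] at hc
    rw [key, key, ← sub_eq_zero, add_sub_add_comm, hc, ← Finset.sum_sub_distrib, Finset.mul_sum,
      ← Finset.sum_add_distrib]
    refine Finset.sum_eq_zero fun i _ ↦ ?_
    rw [hcl i]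
    ring
  obtain ⟨Z, hZs, hZd⟩ := exists_primitive_on_ball hαs hαclosed
  set Φ : E → CoordSpace n := fun x ↦ (fun i ↦ X i x, fun i ↦ Y i x, Z x) with hΦ
  have hΦs : ContDiffOn ℝ ∞ Φ B :=
    (contDiffOn_pi.2 hXs).prodMk ((contDiffOn_pi.2 hYs).prodMk hZs)
  set D : E → E →L[ℝ] CoordSpace n := fun x ↦
    (ContinuousLinearMap.pi fun i ↦ (2 : ℝ) • g x (f i x)).prod
      ((ContinuousLinearMap.pi fun i ↦ (2 : ℝ) • g x (e i x)).prod (α x)) with hDdef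
  have hΦd : ∀ x ∈ B, HasFDerivAt Φ (D x) x := fun x hx ↦
    (hasFDerivAt_pi.2 fun i ↦ hXd i x hx).prodMk
      ((hasFDerivAt_pi.2 fun i ↦ hYd i x hx).prodMk (hZd x hx))
  have hstd := fun x (hx : x ∈ B) ↦ (hfr x hx).1.std_eq (H.algebra x (hsub hx)) (p := Φ x)
    (D := D x) (fun v ↦ by
      refine Prod.ext rfl (Prod.ext rfl ?_)
      simp [hDdef, hα, hΦ, sum_apply])
  have hinj : ∀ x ∈ B, Function.Injective (D x : E →ₗ[ℝ] CoordSpace n) := fun x hx ↦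
    (injective_iff_map_eq_zero _).2 fun v hv ↦ (H.algebra x (hsub hx)).nondegenerate v fun w ↦ by
      rw [← (hstd x hx).2.2.2, show D x v = 0 from hv]
      simp
  have hequiv : ∀ x ∈ B, ∃ L : E ≃L[ℝ] CoordSpace n, (L : E →L[ℝ] CoordSpace n) = D x :=
    fun x hx ↦ ⟨(LinearEquiv.ofInjectiveOfFinrankEq _ (hinj x hx)
      (by rw [hdim]; simp; ring)).toContinuousLinearEquiv, by ext v <;> rfl⟩
  have hxB : x₀ ∈ B := mem_ball_self hr
  obtain ⟨L₀, hL₀⟩ := hequiv x₀ hxB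
  have hc0 : ContDiffAt ℝ ∞ Φ x₀ := hΦs.contDiffAt (hBo.mem_nhds hxB)
  have hd0 : HasFDerivAt Φ (L₀ : E →L[ℝ] CoordSpace n) x₀ := hL₀ ▸ hΦd x₀ hxB
  set Ψ := (hc0.toOpenPartialHomeomorph Φ hd0 (by simp)).restrOpen B hBo with hΨ
  have hcoe : ∀ x, Ψ x = Φ x := fun x ↦ rfl
  have hcoe' : (Ψ : E → CoordSpace n) = Φ := rfl
  have hsource : Ψ.source ⊆ B := fun x hx ↦ by
    rw [hΨ, OpenPartialHomeomorph.restrOpen_source] at hx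
    exact hx.2
  refine ⟨Ψ, ?_, hsource.trans hsub, ?_, ?_, fun q hq ↦ ?_⟩
  · rw [hΨ, OpenPartialHomeomorph.restrOpen_source]
    exact ⟨hc0.mem_toOpenPartialHomeomorph_source hd0 (by simp), hxB⟩
  · exact hΦs.mono hsource
  · intro y hy
    have hq := hsource (Ψ.map_target hy)
    obtain ⟨L, hL⟩ := hequiv _ hq
    exact (Ψ.contDiffAt_symm hy (f₀' := L) (hL ▸ hΦd _ hq)
      (hΦs.contDiffAt (hBo.mem_nhds hq))).contDiffWithinAt
  · rw [hcoe', (hΦd q (hsource hq)).fderiv]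
    exact hstd q (hsource hq)

end NormalForm

/-! ### Vector fields and tensors in a chart -/

section ChartFields

set_option maxSynthPendingDepth 3

open VectorField

variable {E : Type*} [NormedAddCommGroup E] [NormedSpace ℝ E]
  {M : Type*} [TopologicalSpace M] [ChartedSpace E M]

/-- The derivative of the chart `φ` at `x`, with values in the model space. -/
def chartDeriv (φ : OpenPartialHomeomorph M E) (x : M) : TangentSpace 𝓘(ℝ, E) x →L[ℝ] E :=
  mfderiv 𝓘(ℝ, E) 𝓘(ℝ, E) φ x

/-- The inverse of the derivative of the chart `φ` at `x` (zero where the latter is not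
invertible). -/
def chartFrame (φ : OpenPartialHomeomorph M E) (x : M) : E →L[ℝ] TangentSpace 𝓘(ℝ, E) x :=
  (chartDeriv φ x).inverse

/-- The vector field whose components in the chart `φ` are given by `f`. -/
def chartLift (φ : OpenPartialHomeomorph M E) (f : E → E) : VField E M :=
  fun x ↦ chartFrame φ x (f (φ x))

/-- The components in the chart `φ` of a vector field, as a function on the model space. They are
meaningful on the target of `φ` only, as are those of the tensor fields below. -/
def chartField (φ : OpenPartialHomeomorph M E) (X : VField E M) (y : E) : E :=
  chartDeriv φ (φ.symm y) (X (φ.symm y))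

/-- The components in the chart `φ` of a field of endomorphisms. -/
def chartEnd (φ : OpenPartialHomeomorph M E) (A : EndField E M) (y : E) : E →L[ℝ] E :=
  chartDeriv φ (φ.symm y) ∘L A (φ.symm y) ∘L chartFrame φ (φ.symm y)

/-- The components in the chart `φ` of a field of covectors. -/
def chartCov (φ : OpenPartialHomeomorph M E) (η : CovField E M) (y : E) : E →L[ℝ] ℝ :=
  η (φ.symm y) ∘L chartFrame φ (φ.symm y)

/-- The components in the chart `φ` of a field of bilinear forms. -/
def chartBilin (φ : OpenPartialHomeomorph M E) (g : BilinField E M) (y : E) :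
    E →L[ℝ] E →L[ℝ] ℝ :=
  ContinuousLinearMap.precomp ℝ (chartFrame φ (φ.symm y)) ∘L g (φ.symm y) ∘L
    chartFrame φ (φ.symm y)

section Apply

variable {φ : OpenPartialHomeomorph M E} {x : M} (hx : x ∈ φ.source)
include hx

theorem chartField_apply (X : VField E M) : chartField φ X (φ x) = chartDeriv φ x (X x) := by
  rw [chartField, φ.left_inv hx]

theorem chartEnd_apply (A : EndField E M) (u : E) :
    chartEnd φ A (φ x) u = chartDeriv φ x (A x (chartFrame φ x u)) := by
  rw [chartEnd, φ.left_inv hx]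
  rfl

theorem chartCov_apply (η : CovField E M) (u : E) :
    chartCov φ η (φ x) u = η x (chartFrame φ x u) := by
  rw [chartCov, φ.left_inv hx]
  rfl

theorem chartBilin_apply (g : BilinField E M) (u v : E) :
    chartBilin φ g (φ x) u v = g x (chartFrame φ x u) (chartFrame φ x v) := by
  rw [chartBilin, φ.left_inv hx]
  rfl

end Apply

theorem mlieBracket_eq_lieBracket (V W : ∀ y : E, TangentSpace 𝓘(ℝ, E) y) (y : E) :
    mlieBracket 𝓘(ℝ, E) V W y = lieBracket ℝ V W y := by
  rw [← mlieBracketWithin_univ, mlieBracketWithin_eq_lieBracketWithin]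
  exact congrFun lieBracketWithin_univ y

variable {φ : OpenPartialHomeomorph M E}
  (hφ : φ ∈ IsManifold.maximalAtlas 𝓘(ℝ, E) ∞ M) {x : M} (hx : x ∈ φ.source)
include hφ

theorem mdifferentiable_of_mem_maximalAtlas : φ.MDifferentiable 𝓘(ℝ, E) 𝓘(ℝ, E) :=
  ⟨fun _ hy ↦ ((contMDiffAt_of_mem_maximalAtlas hφ hy).mdifferentiableAt
    (by simp)).mdifferentiableWithinAt,
    fun _ hy ↦ ((contMDiffAt_symm_of_mem_maximalAtlas hφ hy).mdifferentiableAt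
    (by simp)).mdifferentiableWithinAt⟩

include hx

theorem isInvertible_chartDeriv : (chartDeriv φ x).IsInvertible :=
  ⟨(mdifferentiable_of_mem_maximalAtlas hφ).mfderiv hx, rfl⟩

theorem chartDeriv_chartFrame (u : E) : chartDeriv φ x (chartFrame φ x u) = u :=
  (isInvertible_chartDeriv hφ hx).self_apply_inverse u

theorem chartFrame_chartDeriv (v : TangentSpace 𝓘(ℝ, E) x) :
    chartFrame φ x (chartDeriv φ x v) = v :=
  (isInvertible_chartDeriv hφ hx).inverse_apply_self v

theorem mvfderiv_chartFrame {s : M → ℝ} {k : E → ℝ} (h : ∀ y ∈ φ.source, s y = k (φ y))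
    (hk : DifferentiableAt ℝ k (φ x)) (u : E) :
    d% s x (chartFrame φ x u) = fderiv ℝ k (φ x) u := by
  have he : s =ᶠ[𝓝 x] k ∘ φ := Filter.eventually_of_mem (φ.open_source.mem_nhds hx) h
  have h1 : d% s x = d% (k ∘ φ) x := by
    rw [mvfderiv, mvfderiv, he.mfderiv_eq]
    ext v
    rfl
  have h2 := mvfderiv_comp_apply (I := 𝓘(ℝ, E)) (I' := 𝓘(ℝ, E)) x hk.mdifferentiableAt
    ((contMDiffAt_of_mem_maximalAtlas hφ hx).mdifferentiableAt (by simp)) (chartFrame φ x u)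
  rw [h1, h2]
  change d% k (φ x) (chartDeriv φ x (chartFrame φ x u)) = _
  rw [chartDeriv_chartFrame hφ hx, mvfderiv, mfderiv_eq_fderiv]
  rfl

theorem contDiffAt_of_contMDiffAt_comp_symm {s : M → ℝ} (hs : CMDiffAt ∞ s x) :
    ContDiffAt ℝ ∞ (fun y ↦ s (φ.symm y)) (φ x) := by
  have h := contMDiffAt_symm_of_mem_maximalAtlas hφ (φ.map_source hx)
  rw [← contMDiffAt_iff_contDiffAt]
  exact ContMDiffAt.comp (φ x) (by rwa [φ.left_inv hx]) h

variable [IsManifold 𝓘(ℝ, E) ∞ M]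

theorem contMDiffAt_chartLift [CompleteSpace E] {f : E → E} (hf : ContDiffAt ℝ ∞ f (φ x)) :
    CMDiffAt ∞ (T% (chartLift φ f)) x :=
  ContMDiffAt.mpullback_vectorField_preimage (n := ∞)
    (contMDiffAt_vectorSpace_iff_contDiffAt.2 hf) (contMDiffAt_of_mem_maximalAtlas hφ hx)
    (isInvertible_chartDeriv hφ hx) (by simp)

theorem mdifferentiableAt_chartLift [CompleteSpace E] {f : E → E} (hf : ContDiffAt ℝ ∞ f (φ x)) :
    MDiffAt (T% (chartLift φ f)) x :=
  (contMDiffAt_chartLift hφ hx hf).mdifferentiableAt (by simp)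

theorem mlieBracket_chartLift [CompleteSpace E] {f h : E → E} (hf : ContDiffAt ℝ ∞ f (φ x))
    (hh : ContDiffAt ℝ ∞ h (φ x)) :
    mlieBracket 𝓘(ℝ, E) (chartLift φ f) (chartLift φ h) x
      = chartFrame φ x (fderiv ℝ h (φ x) (f (φ x)) - fderiv ℝ f (φ x) (h (φ x))) := by
  have : IsManifold 𝓘(ℝ, E) (minSmoothness ℝ 2) M :=
    .of_le (n := ∞) (by simpa using ENat.LEInfty.out)
  have hf' := (contMDiffAt_vectorSpace_iff_contDiffAt.2 hf).mdifferentiableAt (by simp)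
  have hh' := (contMDiffAt_vectorSpace_iff_contDiffAt.2 hh).mdifferentiableAt (by simp)
  have := mpullback_mlieBracket (n := ∞) hf' hh' (contMDiffAt_of_mem_maximalAtlas hφ hx)
    (by simpa using ENat.LEInfty.out)
  refine Eq.trans this.symm ?_
  exact congrArg (chartFrame φ x) (mlieBracket_eq_lieBracket f h (φ x))

/-- The components of a smooth vector field are smooth, since they form its pullback under the
inverse chart. -/
theorem contDiffAt_chartField [CompleteSpace E] {X : VField E M} (hX : CMDiffAt ∞ (T% X) x) :
    ContDiffAt ℝ ∞ (chartField φ X) (φ x) := by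
  have hy := φ.map_source hx
  have h1 := contMDiffAt_symm_of_mem_maximalAtlas hφ hy
  have hD := mdifferentiable_of_mem_maximalAtlas hφ
  have hinv : ∀ y ∈ φ.target, (mfderiv 𝓘(ℝ, E) 𝓘(ℝ, E) φ.symm y).IsInvertible :=
    fun y hy ↦ ⟨hD.symm.mfderiv hy, rfl⟩
  have h2 := ContMDiffAt.mpullback_vectorField_preimage (n := ∞) (m := ∞) (I := 𝓘(ℝ, E))
    (I' := 𝓘(ℝ, E)) (f := φ.symm) (x₀ := φ x) (V := X) (by rwa [φ.left_inv hx]) h1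
    (hinv _ hy) (by simp)
  refine (contMDiffAt_vectorSpace_iff_contDiffAt.1 h2).congr_of_eventuallyEq ?_
  filter_upwards [φ.open_target.mem_nhds hy] with y hy
  rw [mpullback_apply]
  refine (hinv y hy).injective ?_
  rw [(hinv y hy).self_apply_inverse]
  have := hD.symm.comp_symm_deriv (x := φ.symm y) (φ.map_target hy)
  have h3 := DFunLike.congr_fun this (X (φ.symm y))
  simp only [OpenPartialHomeomorph.symm_symm] at h3
  rw [φ.right_inv hy] at h3
  exact h3

end ChartFields

/-! ### Smoothness of the components in a chart -/

section SmoothComponents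

set_option maxSynthPendingDepth 3

variable {E : Type*} [NormedAddCommGroup E] [NormedSpace ℝ E]
  {M : Type*} [TopologicalSpace M] [ChartedSpace E M] [IsManifold 𝓘(ℝ, E) ∞ M]

theorem EndField.Smooth.contMDiffAt {A : EndField E M} (hA : A.Smooth) {x : M}
    {Y : VField E M} (hY : CMDiffAt ∞ (T% Y) x) : CMDiffAt ∞ (T% (fun y ↦ A y (Y y))) x :=
  ContMDiffAt.clm_bundle_apply (b := fun y : M ↦ y) (hA x) hY

theorem CovField.Smooth.contMDiffAt {η : CovField E M} (hη : η.Smooth) {x : M}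
    {Y : VField E M} (hY : CMDiffAt ∞ (T% Y) x) : CMDiffAt ∞ (fun y ↦ η y (Y y)) x := by
  have := ContMDiffAt.clm_bundle_apply (b := fun y : M ↦ y) (hη x) hY
  rw [contMDiffAt_totalSpace] at this
  exact this.2

theorem BilinField.Smooth.contMDiffAt {g : BilinField E M} (hg : g.Smooth) {x : M}
    {Y Z : VField E M} (hY : CMDiffAt ∞ (T% Y) x) (hZ : CMDiffAt ∞ (T% Z) x) :
    CMDiffAt ∞ (fun y ↦ g y (Y y) (Z y)) x := by
  have := ContMDiffAt.clm_bundle_apply₂ (b := fun y : M ↦ y) (hg x) hY hZ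
  rw [contMDiffAt_totalSpace] at this
  exact this.2

variable {φ : OpenPartialHomeomorph M E} (hφ : φ ∈ IsManifold.maximalAtlas 𝓘(ℝ, E) ∞ M)
  [FiniteDimensional ℝ E] [CompleteSpace E]
include hφ

omit [FiniteDimensional ℝ E] in
theorem VField.Smooth.contDiffOn_chartField {X : VField E M} (hX : X.Smooth) :
    ContDiffOn ℝ ∞ (chartField φ X) φ.target := by
  intro y hy
  obtain ⟨x, hx, rfl⟩ : ∃ x ∈ φ.source, φ x = y := ⟨φ.symm y, φ.map_target hy, φ.right_inv hy⟩
  exact (contDiffAt_chartField hφ hx (hX x)).contDiffWithinAt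

theorem EndField.Smooth.contDiffOn_chartEnd {A : EndField E M} (hA : A.Smooth) :
    ContDiffOn ℝ ∞ (chartEnd φ A) φ.target := by
  refine contDiffOn_clm_apply.2 fun u y hy ↦ ?_
  obtain ⟨x, hx, rfl⟩ : ∃ x ∈ φ.source, φ x = y := ⟨φ.symm y, φ.map_target hy, φ.right_inv hy⟩
  have := hA.contMDiffAt (contMDiffAt_chartLift hφ hx (f := fun _ ↦ u) contDiffAt_const)
  exact (contDiffAt_chartField hφ hx this).contDiffWithinAt

theorem CovField.Smooth.contDiffOn_chartCov {η : CovField E M} (hη : η.Smooth) :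
    ContDiffOn ℝ ∞ (chartCov φ η) φ.target := by
  refine contDiffOn_clm_apply.2 fun u y hy ↦ ?_
  obtain ⟨x, hx, rfl⟩ : ∃ x ∈ φ.source, φ x = y := ⟨φ.symm y, φ.map_target hy, φ.right_inv hy⟩
  have := hη.contMDiffAt (contMDiffAt_chartLift hφ hx (f := fun _ ↦ u) contDiffAt_const)
  exact (contDiffAt_of_contMDiffAt_comp_symm hφ hx this).contDiffWithinAt

theorem BilinField.Smooth.contDiffOn_chartBilin {g : BilinField E M} (hg : g.Smooth) :
    ContDiffOn ℝ ∞ (chartBilin φ g) φ.target := by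
  refine contDiffOn_clm_apply.2 fun u ↦ contDiffOn_clm_apply.2 fun v y hy ↦ ?_
  obtain ⟨x, hx, rfl⟩ : ∃ x ∈ φ.source, φ x = y := ⟨φ.symm y, φ.map_target hy, φ.right_inv hy⟩
  have := hg.contMDiffAt (contMDiffAt_chartLift hφ hx (f := fun _ ↦ u) contDiffAt_const)
    (contMDiffAt_chartLift hφ hx (f := fun _ ↦ v) contDiffAt_const)
  exact (contDiffAt_of_contMDiffAt_comp_symm hφ hx this).contDiffWithinAt

end SmoothComponents

/-! ### Connections in a chart -/

section ChartConnection

set_option maxSynthPendingDepth 3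

variable {E : Type*} [NormedAddCommGroup E] [NormedSpace ℝ E]
  {M : Type*} [TopologicalSpace M] [ChartedSpace E M] [IsManifold 𝓘(ℝ, E) ∞ M]

theorem CovariantDerivative.apply_sum_smul
    (cov : CovariantDerivative 𝓘(ℝ, E) E (TangentSpace 𝓘(ℝ, E) : M → Type _))
    {ι : Type*} (s : Finset ι) {c : ι → M → ℝ} {X : ι → VField E M} {x : M}
    (hc : ∀ i, MDiffAt (c i) x) (hX : ∀ i, MDiffAt (T% (X i)) x) :
    cov (fun y ↦ ∑ i ∈ s, c i y • X i y) x
      = ∑ i ∈ s, (c i x • cov (X i) x + (d% (c i) x).smulRight (X i x)) := by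
  classical
  induction s using Finset.induction_on with
  | empty =>
    simp only [Finset.sum_empty]
    exact congrFun cov.zero x
  | insert i s hi ih =>
    have e : (fun y ↦ ∑ i ∈ insert i s, c i y • X i y)
        = c i • X i + fun y ↦ ∑ i ∈ s, c i y • X i y := by
      ext y
      simp [Finset.sum_insert hi]
    have hs : MDiffAt (T% (fun y ↦ ∑ i ∈ s, c i y • X i y)) x :=
      .sum_section (t := fun i y ↦ c i y • X i y) fun j _ ↦ (hc j).smul_section (hX j)
    rw [e, cov.isCovariantDerivativeOnUniv.add ((hc i).smul_section (hX i)) hs, ih,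
      cov.isCovariantDerivativeOnUniv.leibniz (hX i) (hc i), Finset.sum_insert hi]

variable {φ : OpenPartialHomeomorph M E} (hφ : φ ∈ IsManifold.maximalAtlas 𝓘(ℝ, E) ∞ M)
  [FiniteDimensional ℝ E] [CompleteSpace E]
include hφ

/-- The covariant derivative of a vector field in terms of its components and the Christoffel
symbols. -/
theorem CovariantDerivative.apply_chartLift
    (cov : CovariantDerivative 𝓘(ℝ, E) E (TangentSpace 𝓘(ℝ, E) : M → Type _)) {x : M}
    (hx : x ∈ φ.source) {Γ : E →L[ℝ] E →L[ℝ] E}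
    (hΓ : ∀ u v, cov (chartLift φ fun _ ↦ v) x (chartFrame φ x u) = chartFrame φ x (Γ u v))
    {f : E → E} (hf : ContDiffAt ℝ ∞ f (φ x)) (u : E) :
    cov (chartLift φ f) x (chartFrame φ x u)
      = chartFrame φ x (fderiv ℝ f (φ x) u + Γ u (f (φ x))) := by
  set b := Module.finBasis ℝ E
  set ℓ : Fin (Module.finrank ℝ E) → E →L[ℝ] ℝ := fun i ↦
    LinearMap.toContinuousLinearMap (b.coord i)
  have hb : ∀ v : E, ∑ i, ℓ i v • b i = v := fun v ↦ b.sum_repr v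
  have e : chartLift φ f = fun y ↦ ∑ i, ℓ i (f (φ y)) • chartLift φ (fun _ ↦ b i) y := by
    ext1 y
    simp only [chartLift]
    conv_lhs => rw [← hb (f (φ y)), map_sum]
    simp only [map_smul]
  have hℓ : ∀ i, ContDiffAt ℝ ∞ (fun y ↦ ℓ i (f y)) (φ x) := fun i ↦
    (ℓ i).contDiff.contDiffAt.comp (φ x) hf
  have hd : ∀ i, d% (fun y ↦ ℓ i (f (φ y))) x (chartFrame φ x u) = ℓ i (fderiv ℝ f (φ x) u) :=
    fun i ↦ by
      have h : HasFDerivAt (fun y ↦ ℓ i (f y)) _ (φ x) :=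
        (ℓ i).hasFDerivAt.comp (φ x) (hf.differentiableAt (by simp)).hasFDerivAt
      rw [mvfderiv_chartFrame hφ hx (fun y _ ↦ rfl) h.differentiableAt, h.fderiv]
      rfl
  rw [e, cov.apply_sum_smul Finset.univ (c := fun i y ↦ ℓ i (f (φ y)))
    (X := fun i ↦ chartLift φ fun _ ↦ b i)
    (fun i ↦ (((hℓ i).contMDiffAt.comp x (contMDiffAt_of_mem_maximalAtlas hφ hx)).mdifferentiableAt
      (by simp)))
    (fun i ↦ mdifferentiableAt_chartLift hφ hx contDiffAt_const)]
  rw [sum_apply]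
  simp only [add_apply, smul_apply, ContinuousLinearMap.smulRight_apply, hΓ, hd]
  simp only [chartLift, ← map_smul, ← map_add, ← map_sum]
  rw [Finset.sum_add_distrib, hb, ← map_sum (Γ u), hb, add_comm]

/-- In a chart, the vanishing of the curvature is the flatness of the Christoffel symbols. -/
theorem IsFlatConnection.isFlatOn
    {cov : CovariantDerivative 𝓘(ℝ, E) E (TangentSpace 𝓘(ℝ, E) : M → Type _)}
    (hcov : IsFlatConnection cov) {Γ : E → E →L[ℝ] E →L[ℝ] E}
    (hΓs : ContDiffOn ℝ ∞ Γ φ.target)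
    (hΓ : ∀ x ∈ φ.source, ∀ u v,
      cov (chartLift φ fun _ ↦ v) x (chartFrame φ x u) = chartFrame φ x (Γ (φ x) u v)) :
    IsFlatOn φ.target Γ := by
  intro y hy u w v
  obtain ⟨x, hx, rfl⟩ : ∃ x ∈ φ.source, φ x = y := ⟨φ.symm y, φ.map_target hy, φ.right_inv hy⟩
  have hΓc : ContDiffAt ℝ ∞ Γ (φ x) := hΓs.contDiffAt (φ.open_target.mem_nhds hy)
  have hΓd : HasFDerivAt Γ (fderiv ℝ Γ (φ x)) (φ x) :=
    (hΓc.differentiableAt (by simp)).hasFDerivAt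
  have hc : ∀ v : E, ContDiffAt ℝ ∞ (fun _ : E ↦ v) (φ x) := fun v ↦ contDiffAt_const
  have hfΓ : ∀ w v, ContDiffAt ℝ ∞ (fun z ↦ Γ z w v) (φ x) := fun w v ↦
    (hΓc.clm_apply (hc w)).clm_apply (hc v)
  have key : ∀ u w v, cov (fun y ↦ cov (chartLift φ fun _ ↦ v) y (chartLift φ (fun _ ↦ w) y)) x
      (chartLift φ (fun _ ↦ u) x)
      = chartFrame φ x (fderiv ℝ Γ (φ x) u w v + Γ (φ x) u (Γ (φ x) w v)) := fun u w v ↦ by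
    have he : ∀ᶠ y in 𝓝 x, chartLift φ (fun z ↦ Γ z w v) y
        = cov (chartLift φ fun _ ↦ v) y (chartLift φ (fun _ ↦ w) y) :=
      Filter.eventually_of_mem (φ.open_source.mem_nhds hx) fun y hy ↦ (hΓ y hy w v).symm
    have hm := mdifferentiableAt_chartLift hφ hx (hfΓ w v)
    have hm' : MDiffAt (T% (fun y ↦ cov (chartLift φ fun _ ↦ v) y (chartLift φ (fun _ ↦ w) y))) x :=
      hm.congr_of_eventuallyEq (he.mono fun y hy ↦ by simp only [hy])
    rw [← cov.isCovariantDerivativeOnUniv.congr_of_eventuallyEq hm hm' Filter.univ_mem he]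
    have := cov.apply_chartLift hφ hx (hΓ x hx) (hfΓ w v) u
    have hd := ((hΓd.clm_apply (hasFDerivAt_const w (φ x))).clm_apply
      (hasFDerivAt_const v (φ x))).fderiv
    rw [hd] at this
    refine this.trans (congrArg (chartFrame φ x) ?_)
    simp
  have h := hcov x _ _ _ (contMDiffAt_chartLift hφ hx (hc u)) (contMDiffAt_chartLift hφ hx (hc w))
    (contMDiffAt_chartLift hφ hx (hc v))
  have h' := congrArg (chartDeriv φ x) h
  rw [affineCurvature, key, key, mlieBracket_chartLift hφ hx (hc u) (hc w)] at h'
  simp [chartDeriv_chartFrame hφ hx] at h'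
  rw [← h']
  abel

end ChartConnection

/-! ### Para-Sasakian manifolds in a chart -/

section ParaSasakian

set_option maxSynthPendingDepth 3

open VectorField

variable {E : Type*} [NormedAddCommGroup E] [NormedSpace ℝ E]
  {M : Type*} [TopologicalSpace M] [ChartedSpace E M] [IsManifold 𝓘(ℝ, E) ∞ M]

namespace ParacontactTensors

variable {n : ℕ} {S : ParacontactTensors E M}

theorem IsParacontactMetric.isParacontactAlgebra (hS : S.IsParacontactMetric n) (x : M) :
    IsParacontactAlgebra (S.ψ x) (S.ξ x) (S.η x) (S.g x) where
  η_ξ := hS.η_ξ x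
  ψ_sq := hS.ψ_sq x
  symm := hS.metric.symm x
  nondegenerate := hS.metric.nondegenerate x
  compatible := hS.compatible x

/-- The Reeb field of a para-Sasakian manifold preserves `ψ`. -/
theorem IsParaSasakian.h_eq_zero [FiniteDimensional ℝ E] [CompleteSpace E]
    (hS : S.IsParaSasakian n) (x : M) : hS.h x = 0 := by
  have A := hS.isParacontactAlgebra
  have hξ : MDiffAt (T% S.ξ) x := (hS.smooth_ξ x).mdifferentiableAt (by simp)
  ext v
  set X : VField E M := FiberBundle.extend E v with hXdef
  have hX : MDiffAt (T% X) x := FiberBundle.mdifferentiableAt_extend ..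
  have hXv : X x = v := FiberBundle.extend_apply_self ..
  have hψX := hS.smooth_ψ.mdifferentiableAt hX
  set w := mlieBracket 𝓘(ℝ, E) S.ξ (fun y ↦ S.ψ y (X y)) x
    - S.ψ x (mlieBracket 𝓘(ℝ, E) S.ξ X x) with hw
  have hψξ : (fun y ↦ S.ψ y (S.ξ y)) = (0 : VField E M) := funext fun y ↦ (A y).ψ_ξ
  -- Normality, evaluated on `(ξ, X)`, shows `ψ w = 0`.
  have h1 : S.ψ x w = 0 := by
    have := hS.normal x S.ξ X hξ hX
    rw [hS.contact x S.ξ X hξ hX, (A x).g_ξ, (A x).η_ψ, nijenhuis, hψξ] at this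
    simp only [mlieBracket_zero_left, Pi.zero_apply, map_zero, mul_zero, zero_smul, sub_zero,
      add_zero] at this
    rw [hw, map_sub, ← neg_eq_zero, neg_sub]
    exact this
  -- The contact condition, evaluated on `(ξ, ψX)`, shows `η w = 0`.
  have h2 : S.η x w = 0 := by
    have := hS.contact x S.ξ (fun y ↦ S.ψ y (X y)) hξ hψX
    have e1 : (fun y ↦ S.η y (S.ψ y (X y))) = fun _ ↦ 0 := funext fun y ↦ (A y).η_ψ _
    have e2 : (fun y ↦ S.η y (S.ξ y)) = fun _ ↦ 1 := funext fun y ↦ (A y).η_ξ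
    rw [(A x).g_ξ, (A x).η_ψ, extDerivForm, e1, e2, mvfderiv_const, mvfderiv_const] at this
    rw [hw, map_sub, (A x).η_ψ]
    simpa using this
  have h3 : w = 0 := by
    have := (A x).ψ_sq w
    rw [h1, h2, map_zero, zero_smul, sub_zero] at this
    exact this.symm
  have := hS.h_apply hX
  rw [hXv] at this
  rw [this, ← hw, h3, smul_zero]
  rfl

variable [FiniteDimensional ℝ E] [CompleteSpace E]
  {φ : OpenPartialHomeomorph M E} (hφ : φ ∈ IsManifold.maximalAtlas 𝓘(ℝ, E) ∞ M)
include hφ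

/-- The components of a para-Sasakian structure in a chart form such a structure on the target of
the chart: its axioms are evaluated on the coordinate fields, which commute. -/
theorem IsParaSasakian.isParaSasakianOn (hS : S.IsParaSasakian n) :
    IsParaSasakianOn φ.target (chartEnd φ S.ψ) (chartField φ S.ξ) (chartCov φ S.η)
      (chartBilin φ S.g) := by
  have hc : ∀ {v y : E}, ContDiffAt ℝ ∞ (fun _ : E ↦ v) y := contDiffAt_const
  have hψs := hS.smooth_ψ.contDiffOn_chartEnd hφ
  have hηs := hS.smooth_η.contDiffOn_chartCov hφ
  have hψd : ∀ {x : M}, x ∈ φ.source → HasFDerivAt (chartEnd φ S.ψ) _ (φ x) := fun hx ↦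
    hasFDerivAt_of_contDiffOn φ.open_target hψs (φ.map_source hx)
  have hηd : ∀ {x : M}, x ∈ φ.source → HasFDerivAt (chartCov φ S.η) _ (φ x) := fun hx ↦
    hasFDerivAt_of_contDiffOn φ.open_target hηs (φ.map_source hx)
  have hF : ∀ {x : M}, x ∈ φ.source → ∀ v, chartDeriv φ x (chartFrame φ x v) = v := fun hx ↦
    chartDeriv_chartFrame hφ hx
  have hD : ∀ {x : M}, x ∈ φ.source → ∀ v, chartFrame φ x (chartDeriv φ x v) = v := fun hx ↦
    chartFrame_chartDeriv hφ hx
  refine ⟨φ.open_target, hψs, hS.smooth_ξ.contDiffOn_chartField hφ, hηs,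
    hS.metric.smooth.contDiffOn_chartBilin hφ, fun y hy ↦ ?_, fun y hy u v ↦ ?_,
    fun y hy u v ↦ ?_⟩ <;>
  obtain ⟨x, hx, rfl⟩ : ∃ x ∈ φ.source, φ x = y := ⟨φ.symm y, φ.map_target hy, φ.right_inv hy⟩
  · have A := hS.isParacontactAlgebra x
    refine ⟨?_, fun v ↦ ?_, fun v w ↦ ?_, fun v hv ↦ ?_, fun v w ↦ ?_⟩
    · rw [chartCov_apply hx, chartField_apply hx, hD hx, A.η_ξ]
    · rw [chartEnd_apply hx, chartEnd_apply hx, hD hx, A.ψ_sq, map_sub, map_smul, hF hx,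
        chartCov_apply hx, chartField_apply hx]
    · rw [chartBilin_apply hx, chartBilin_apply hx, A.symm]
    · rw [← hF hx v, A.nondegenerate (chartFrame φ x v) fun w ↦ ?_, map_zero]
      rw [← hD hx w, ← chartBilin_apply hx, hv]
    · simp only [chartBilin_apply hx, chartEnd_apply hx, chartCov_apply hx, hD hx, A.compatible]
  · have h := hS.contact x _ _ (mdifferentiableAt_chartLift hφ hx (hc (v := u)))
      (mdifferentiableAt_chartLift hφ hx (hc (v := v)))
    have hk : ∀ u v, d% (fun y ↦ S.η y (chartLift φ (fun _ ↦ v) y)) x (chartLift φ (fun _ ↦ u) x)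
        = fderiv ℝ (chartCov φ S.η) (φ x) u v := fun u v ↦ by
      have hd := (hηd hx).clm_apply (hasFDerivAt_const v (φ x))
      refine (mvfderiv_chartFrame hφ hx (k := fun z ↦ chartCov φ S.η z v)
        (fun y hy ↦ (chartCov_apply hy _ _).symm) hd.differentiableAt u).trans ?_
      rw [hd.fderiv]
      simp
    rw [extDerivForm, hk, hk, mlieBracket_chartLift hφ hx hc hc] at h
    rw [chartBilin_apply hx, chartEnd_apply hx, hD hx]
    simp only [fderiv_fun_const, Pi.zero_apply, zero_apply, sub_zero, map_zero] at h
    simp only [chartLift] at h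
    linarith
  · have h := hS.normal x _ _ (mdifferentiableAt_chartLift hφ hx (hc (v := u)))
      (mdifferentiableAt_chartLift hφ hx (hc (v := v)))
    rw [hS.contact x _ _ (mdifferentiableAt_chartLift hφ hx (hc (v := u)))
      (mdifferentiableAt_chartLift hφ hx (hc (v := v))), nijenhuis] at h
    have hs : ∀ v, ContDiffAt ℝ ∞ (fun z ↦ chartEnd φ S.ψ z v) (φ x) := fun v ↦
      (hψs.contDiffAt (φ.open_target.mem_nhds hy)).clm_apply hc
    have hd : ∀ v, fderiv ℝ (fun z ↦ chartEnd φ S.ψ z v) (φ x) = _ := fun v ↦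
      ((hψd hx).clm_apply (hasFDerivAt_const v (φ x))).fderiv
    have he : ∀ v, (fun y ↦ S.ψ y (chartLift φ (fun _ ↦ v) y))
        =ᶠ[𝓝 x] chartLift φ fun z ↦ chartEnd φ S.ψ z v := fun v ↦
      Filter.eventually_of_mem (φ.open_source.mem_nhds hx) fun y hy ↦ by
        simp only [chartLift, chartEnd_apply hy, hD hy]
        rfl
    rw [(he u).mlieBracket_vectorField_eq (he v),
      (he u).mlieBracket_vectorField_eq (.refl _ (chartLift φ fun _ ↦ v)),
      (Filter.EventuallyEq.refl _ (chartLift φ fun _ ↦ u)).mlieBracket_vectorField_eq (he v),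
      mlieBracket_chartLift hφ hx hc hc, mlieBracket_chartLift hφ hx (hs u) (hs v),
      mlieBracket_chartLift hφ hx (hs u) hc, mlieBracket_chartLift hφ hx hc (hs v), hd, hd] at h
    have h' := congrArg (chartDeriv φ x) h
    simp only [map_sub, map_add, hF hx, map_smul, map_zero] at h'
    simp only [chartLift, ← chartEnd_apply hx, ← chartField_apply hx] at h'
    simp at h'
    have hg : chartBilin φ S.g (φ x) u (chartEnd φ S.ψ (φ x) v)
        = S.g x (chartFrame φ x u) (S.ψ x (chartFrame φ x v)) := by
      rw [chartBilin_apply hx, chartEnd_apply hx, hD hx]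
    rw [hg]
    exact sub_eq_zero.1 h'

/-- In a chart, the Levi-Civita connection is given by the Christoffel symbols: on coordinate fields
the bracket terms of the Koszul formula vanish. -/
theorem _root_.IsSemiRiemannian.leviCivita_chartLift {g : BilinField E M}
    (hg : IsSemiRiemannian g) {x : M} (hx : x ∈ φ.source) (u v : E) :
    hg.leviCivita (chartLift φ fun _ ↦ v) x (chartFrame φ x u)
      = chartFrame φ x (christoffel (chartBilin φ g) (φ x) u v) := by
  have hc : ∀ {v y : E}, ContDiffAt ℝ ∞ (fun _ : E ↦ v) y := contDiffAt_const
  have hF : ∀ v, chartDeriv φ x (chartFrame φ x v) = v := chartDeriv_chartFrame hφ hx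
  have hD : ∀ v, chartFrame φ x (chartDeriv φ x v) = v := chartFrame_chartDeriv hφ hx
  have hnd : ∀ v, (∀ w, chartBilin φ g (φ x) v w = 0) → v = 0 := fun v hv ↦ by
    rw [← hF v, hg.nondegenerate x (chartFrame φ x v) fun w ↦ ?_, map_zero]
    rw [← hD w, ← chartBilin_apply hx, hv]
  have hd := hasFDerivAt_of_contDiffOn φ.open_target (hg.smooth.contDiffOn_chartBilin hφ)
    (φ.map_source hx)
  have hk : ∀ u v w, d% (fun y ↦ g y (chartLift φ (fun _ ↦ v) y) (chartLift φ (fun _ ↦ w) y)) x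
      (chartLift φ (fun _ ↦ u) x) = fderiv ℝ (chartBilin φ g) (φ x) u v w := fun u v w ↦ by
    have hd' := (hd.clm_apply (hasFDerivAt_const v (φ x))).clm_apply (hasFDerivAt_const w (φ x))
    refine (mvfderiv_chartFrame hφ hx (k := fun z ↦ chartBilin φ g z v w)
      (fun y hy ↦ (chartBilin_apply hy _ _ _).symm) hd'.differentiableAt u).trans ?_
    rw [hd'.fderiv]
    simp
  have hb : ∀ u v : E, mlieBracket 𝓘(ℝ, E) (chartLift φ fun _ ↦ u) (chartLift φ fun _ ↦ v) x = 0 :=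
    fun u v ↦ by
      rw [mlieBracket_chartLift hφ hx hc hc]
      simp
  refine sub_eq_zero.1 (hg.nondegenerate x _ fun w ↦ ?_)
  have h := hg.two_mul_apply_leviCivitaFun (mdifferentiableAt_chartLift hφ hx (hc (v := u)))
    (mdifferentiableAt_chartLift hφ hx (hc (v := v)))
    (mdifferentiableAt_chartLift hφ hx (hc (v := chartDeriv φ x w)))
  have h' := two_mul_apply_christoffel hnd u v (chartDeriv φ x w)
  rw [koszul, hk, hk, hk, hb, hb, hb] at h
  rw [chartBilin_apply hx, hD] at h'
  simp only [map_zero, zero_apply, add_zero, sub_zero, chartLift, hD] at h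
  rw [map_sub, sub_apply]
  change g x (hg.leviCivitaFun _ x _) w - _ = 0
  linarith

theorem IsParaSasakian.canonicalConnection_chartLift (hS : S.IsParaSasakian n) {x : M}
    (hx : x ∈ φ.source) (u v : E) :
    hS.canonicalConnection (chartLift φ fun _ ↦ v) x (chartFrame φ x u)
      = chartFrame φ x (canonicalChristoffel (chartEnd φ S.ψ) (chartField φ S.ξ) (chartCov φ S.η)
          (chartBilin φ S.g) (φ x) u v) := by
  have hD : ∀ v, chartFrame φ x (chartDeriv φ x v) = v := chartFrame_chartDeriv hφ hx
  refine (hS.canonicalConnection_apply (chartLift φ fun _ ↦ u) (chartLift φ fun _ ↦ v) x).trans ?_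
  rw [canonicalChristoffel_apply, hS.h_eq_zero]
  simp only [zero_apply, map_zero, sub_zero, map_add, map_smul, chartEnd_apply hx, hD,
    chartCov_apply hx, chartBilin_apply hx, chartField_apply hx]
  simp only [chartLift]
  rw [hS.metric.leviCivita_chartLift hφ hx]

omit [IsManifold 𝓘(ℝ, E) ∞ M] [FiniteDimensional ℝ E] [CompleteSpace E] in
theorem finrank_chart_eigenDistribution {x : M} (hx : x ∈ φ.source) (c : ℝ) :
    Module.finrank ℝ ↥(LinearMap.ker (chartCov φ S.η (φ x) : E →ₗ[ℝ] ℝ) ⊓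
      Module.End.eigenspace (chartEnd φ S.ψ (φ x) : E →ₗ[ℝ] E) c)
      = Module.finrank ℝ (S.eigenDistribution c x) := by
  have hF : ∀ v, chartDeriv φ x (chartFrame φ x v) = v := chartDeriv_chartFrame hφ hx
  have hD : ∀ v, chartFrame φ x (chartDeriv φ x v) = v := chartFrame_chartDeriv hφ hx
  let e : TangentSpace 𝓘(ℝ, E) x ≃ₗ[ℝ] E :=
    { (chartDeriv φ x : TangentSpace 𝓘(ℝ, E) x →ₗ[ℝ] E) with
      invFun := chartFrame φ x
      left_inv := hD
      right_inv := hF }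
  suffices h : LinearMap.ker (chartCov φ S.η (φ x) : E →ₗ[ℝ] ℝ) ⊓
      Module.End.eigenspace (chartEnd φ S.ψ (φ x) : E →ₗ[ℝ] E) c
        = (S.eigenDistribution c x).map (e : TangentSpace 𝓘(ℝ, E) x →ₗ[ℝ] E) by
    rw [h]
    exact LinearEquiv.finrank_map_eq e _
  ext w
  have he : e.symm w = chartFrame φ x w := rfl
  rw [Submodule.mem_map_equiv, eigenDistribution, Submodule.mem_inf, Submodule.mem_inf,
    LinearMap.mem_ker, LinearMap.mem_ker, Module.End.mem_eigenspace_iff,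
    Module.End.mem_eigenspace_iff, he]
  simp only [ContinuousLinearMap.coe_coe, chartCov_apply hx, chartEnd_apply hx]
  refine and_congr_right fun _ ↦ ⟨fun h ↦ ?_, fun h ↦ ?_⟩
  · rw [← map_smul, ← h, hD]
  · rw [h, map_smul, hF]

end ParacontactTensors

end ParaSasakian

end

theorem mainTheorem10 (n : ℕ) {M : Type*} [TopologicalSpace M]
    [ChartedSpace (EuclideanSpace ℝ (Fin (2 * n + 1))) M]
    [IsManifold 𝓘(ℝ, EuclideanSpace ℝ (Fin (2 * n + 1))) ∞ M]
    (S : ParacontactTensors (EuclideanSpace ℝ (Fin (2 * n + 1))) M)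
    (hS : S.IsParaSasakian n)
    (hflat : IsFlatConnection hS.toIsParacontactMetric.canonicalConnection) :
    S.LocallyIsomorphic (stdParaSasakian n) := by
  intro p
  set E := EuclideanSpace ℝ (Fin (2 * n + 1))
  set φ : OpenPartialHomeomorph M E := chartAt E p with hφdef
  have hφ : φ ∈ IsManifold.maximalAtlas 𝓘(ℝ, E) ∞ M := IsManifold.chart_mem_maximalAtlas p
  have hp : p ∈ φ.source := mem_chart_source E p
  have H := hS.isParaSasakianOn hφ
  have hflat' := hflat.isFlatOn hφ H.contDiffOn_canonicalChristoffel fun x hx u v ↦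
    hS.canonicalConnection_chartLift hφ hx u v
  obtain ⟨Ψ, hpΨ, hΨφ, hΨ, hΨ', hstd⟩ := H.exists_normal_form hflat' (φ.map_source hp)
    (n := n) (by simp [E])
    ((ParacontactTensors.finrank_chart_eigenDistribution hφ hp 1).trans (hS.finrank_pos p))
    ((ParacontactTensors.finrank_chart_eigenDistribution hφ hp (-1)).trans (hS.finrank_neg p))
  have hsource : (φ.trans Ψ).source = φ.source ∩ φ ⁻¹' Ψ.source := φ.trans_source Ψ
  have htarget : (φ.trans Ψ).target = Ψ.target ∩ Ψ.symm ⁻¹' φ.target := φ.trans_target Ψ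
  refine ⟨φ.trans Ψ, hsource ▸ ⟨hp, hpΨ⟩, ?_, ?_, fun q hq ↦ ?_⟩
  · rw [hsource]
    exact hΨ.contMDiffOn.comp' (contMDiffOn_of_mem_maximalAtlas hφ)
  · rw [htarget]
    exact (contMDiffOn_symm_of_mem_maximalAtlas hφ).comp' hΨ'.contMDiffOn
  · rw [hsource] at hq
    have hD : ∀ v, chartFrame φ q (chartDeriv φ q v) = v := chartFrame_chartDeriv hφ hq.1
    have hd : ∀ v, mfderiv 𝓘(ℝ, E) 𝓘(ℝ, CoordSpace n) (φ.trans Ψ) q v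
        = fderiv ℝ Ψ (φ q) (chartDeriv φ q v) := fun v ↦ by
      have h1 : MDifferentiableAt 𝓘(ℝ, E) 𝓘(ℝ, CoordSpace n) Ψ (φ q) :=
        ((hΨ.contDiffAt (Ψ.open_source.mem_nhds hq.2)).differentiableAt
          (by simp)).mdifferentiableAt
      have h2 := (contMDiffAt_of_mem_maximalAtlas hφ hq.1).mdifferentiableAt (by simp)
      have := mfderiv_comp_apply q h1 h2 v
      rw [mfderiv_eq_fderiv] at this
      exact this
    obtain ⟨h1, h2, h3, h4⟩ := hstd (φ q) hq.2
    refine ⟨fun v ↦ ?_, ?_, fun v ↦ ?_, fun v w ↦ ?_⟩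
    · have := h1 (chartDeriv φ q v)
      rw [chartEnd_apply hq.1, hD] at this
      rw [hd, hd]
      exact this
    · rw [chartField_apply hq.1] at h2
      rw [hd]
      exact h2
    · have := h3 (chartDeriv φ q v)
      rw [chartCov_apply hq.1, hD] at this
      rw [hd]
      exact this
    · have := h4 (chartDeriv φ q v) (chartDeriv φ q w)
      rw [chartBilin_apply hq.1, hD, hD] at this
      rw [hd, hd]
      exact this
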